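/- Let $G$ be a finitely generated group. For $f:G\to\mathbb{C}$ and $u\in G$ put $\partial_u f(x)=f(ux)-f(x)$. For an integer $k\ge 0$ let $P^k(G)$ be the complex vector space of all functions $f:G\to\mathbb{C}$ such that $\partial_{u_1}\cdots\partial_{u_{k+1}}f=0$ for all $u_1,\dots,u_{k+1}\in G$ (the polynomials of degree at most $k$ on $G$), and let $P^k(G)=\{0\}$ for $k<0$. Let $G_1=G$ and $G_{j+1}=[G,G_j]$ for $j\ge 1$ be the lower central series of $G$, and let $d_j$ denote the torsion-free rank of the abelian group $G_j/G_{j+1}$. Then every $d_j$ is finite, and for every integer $k$ the space $P^k(G)$ is finite-dimensional and $\dim P^k(G)$ is equal to the (finite) number of families $(x_{j,t}: 1\le j\le k,\ 1\le t\le d_j)$ of non-negative integers that satisfy $$\sum_{j=1}^{k} j\sum_{t=1}^{d_j}x_{j,t}\le k.$$ (For $k\le 0$ the family is empty and the sum on the left is $0$.) -/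

import Mathlib

/-- The left derivative `∂_u`, given by `(∂_u f)(x) = f (u x) - f x`, as a linear operator on
the functions `G → ℂ`. -/
def leftDeriv {G : Type*} [Group G] (u : G) : (G → ℂ) →ₗ[ℂ] (G → ℂ) where
  toFun f := fun x => f (u * x) - f x
  map_add' f g := by
    funext x
    simp only [Pi.add_apply]
    ring
  map_smul' c f := by
    funext x
    simp only [Pi.smul_apply, smul_eq_mul, RingHom.id_apply]
    ring

/-- The iterated derivative `∂_{u₁} ⋯ ∂_{uₘ}` of a list `[u₁, …, uₘ]` of elements of `G`. -/
def iterLeftDeriv {G : Type*} [Group G] (us : List G) (f : G → ℂ) : G → ℂ :=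
  us.foldr (fun u g => leftDeriv u g) f

theorem iterLeftDeriv_add {G : Type*} [Group G] (us : List G) (f g : G → ℂ) :
    iterLeftDeriv us (f + g) = iterLeftDeriv us f + iterLeftDeriv us g := by
  induction us with
  | nil => rfl
  | cons u us ih =>
    simp only [iterLeftDeriv, List.foldr_cons] at ih ⊢
    rw [ih, map_add]

theorem iterLeftDeriv_smul {G : Type*} [Group G] (us : List G) (c : ℂ) (f : G → ℂ) :
    iterLeftDeriv us (c • f) = c • iterLeftDeriv us f := by
  induction us with
  | nil => rfl
  | cons u us ih =>
    simp only [iterLeftDeriv, List.foldr_cons] at ih ⊢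
    rw [ih, map_smul]

/-- The space of polynomials `f : G → ℂ` of degree at most `k`, for a natural number `k`:
all derivatives `∂_{u₁} ⋯ ∂_{u_{k+1}} f` vanish. -/
def polyOfDegreeLE (G : Type*) [Group G] (k : ℕ) : Submodule ℂ (G → ℂ) where
  carrier := {f | ∀ us : List G, us.length = k + 1 → iterLeftDeriv us f = 0}
  add_mem' {f g} hf hg us hus := by
    rw [iterLeftDeriv_add, hf us hus, hg us hus, add_zero]
  zero_mem' us _ := by
    have h := iterLeftDeriv_smul us 0 0
    rwa [zero_smul, zero_smul] at h
  smul_mem' c f hf us hus := by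
    rw [iterLeftDeriv_smul, hf us hus, smul_zero]

/-- The space `P^k(G)` for an integer `k`, with `P^k(G) = {0}` for `k < 0`. -/
def polySpace (G : Type*) [Group G] : ℤ → Submodule ℂ (G → ℂ)
  | Int.ofNat k => polyOfDegreeLE G k
  | Int.negSucc _ => ⊥

/-- The term `G_j` (`j ≥ 1`) of the lower central series, indexed so that `G_1 = G` and
`G_{j+1} = [G, G_j]`. Mathlib's indexing starts at `0`. (The value at `j = 0` is not used.) -/
def lowerCentralTerm (G : Type*) [Group G] (j : ℕ) : Subgroup G :=
  (⊤ : Subgroup G).lowerCentralSeries (j - 1)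

theorem lowerCentralTerm_one (G : Type*) [Group G] : lowerCentralTerm G 1 = ⊤ := rfl

theorem lowerCentralTerm_succ (G : Type*) [Group G] (j : ℕ) (hj : 1 ≤ j) :
    lowerCentralTerm G (j + 1) = ⁅lowerCentralTerm G 1, lowerCentralTerm G j⁆ := by
  obtain ⟨i, rfl⟩ : ∃ i, j = i + 1 := ⟨j - 1, by omega⟩
  rw [Subgroup.commutator_comm]
  rfl

instance lowerCentralTerm_normal (G : Type*) [Group G] (j : ℕ) :
    (lowerCentralTerm G j).Normal :=
  Subgroup.lowerCentralSeries_normal _ _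

/-- The quotient `G_j / G_{j+1}`. -/
abbrev lowerCentralQuotient (G : Type*) [Group G] (j : ℕ) : Type _ :=
  lowerCentralTerm G j ⧸ (lowerCentralTerm G (j + 1)).subgroupOf (lowerCentralTerm G j)

theorem lowerCentralQuotient_mul_comm (G : Type*) [Group G] (j : ℕ)
    (a b : lowerCentralQuotient G j) : a * b = b * a := by
  induction a using QuotientGroup.induction_on with
  | H x =>
    induction b using QuotientGroup.induction_on with
    | H y =>
      rw [← QuotientGroup.mk_mul, ← QuotientGroup.mk_mul, QuotientGroup.eq,
        Subgroup.mem_subgroupOf]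
      rcases Nat.eq_zero_or_pos j with rfl | hj
      · exact Subgroup.mem_top _
      · rw [lowerCentralTerm_succ G j hj]
        have h := Subgroup.commutator_mem_commutator
          (show (y : G)⁻¹ ∈ lowerCentralTerm G 1 from Subgroup.mem_top _) (inv_mem x.2)
        convert h using 1
        simp [commutatorElement_def, mul_assoc]

instance lowerCentralQuotient_commGroup (G : Type*) [Group G] (j : ℕ) :
    CommGroup (lowerCentralQuotient G j) :=
  { (inferInstance : Group (lowerCentralQuotient G j)) with
    mul_comm := lowerCentralQuotient_mul_comm G j }

/-- The torsion-free rank of an abelian group `A` as a cardinal: the rank of `A` as a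
`ℤ`-module, that is, the supremum of the cardinalities of its `ℤ`-independent subsets. -/
noncomputable def torsionFreeRank (A : Type*) [CommGroup A] : Cardinal :=
  Module.rank ℤ (Additive A)

/-- The torsion-free rank `d_j` of `G_j / G_{j+1}`, as a natural number. -/
noncomputable def lowerCentralRank (G : Type*) [Group G] (j : ℕ) : ℕ :=
  Cardinal.toNat (torsionFreeRank (lowerCentralQuotient G j))

/-- The families `(x_{j,t})` of non-negative integers, with `1 ≤ j ≤ k` and `t` in an index set
of size `d j`, that satisfy `∑_{j=1}^k j ∑_t x_{j,t} ≤ k`. -/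
def weightedSolutions (d : ℕ → ℕ) (k : ℤ) :
    Set ((j : Finset.Icc 1 k.toNat) → Fin (d j) → ℕ) :=
  {x | ((∑ j : Finset.Icc 1 k.toNat, (j : ℕ) * ∑ t : Fin (d j), x j t : ℕ) : ℤ) ≤ k}

/-!
The proof filters `G` by the isolators `Γ_j = {g | g ^ n ∈ G_j for some n ≠ 0}` of the lower central
series. Since the torsion elements of a nilpotent group form a subgroup and roots of commuting
elements commute in a torsion-free nilpotent group, the `Γ_j` are subgroups with
`[Γ_i, Γ_j] ≤ Γ_{i+j}` and torsion-free quotients (`commutator_mem_lowerCentralIsolator`). As `G` is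
finitely generated, `Γ_j / Γ_{j+1}` is free abelian of rank `d_j` (`exists_hom_isolator`).

If `h ∈ Γ_j` then `∂_h` lowers the degree of a polynomial by `j`: this holds for commutators, and it
passes from a power of `h` to `h`. Therefore `P^k(G)` is the space `filteredPoly Γ (k + 1)` of the
functions killed by all derivatives of total weight at least `k + 1`
(`filteredPoly_isolator_eq`), and such a space exists for every subgroup `H` of `G`, filtered by the
groups `H ∩ Γ_j`.

The dimension is computed along a chain of subgroups from `Γ_{k+1}` up to `G` that refines the
isolator series and has infinite cyclic quotients. For a step `H < K` of weight `w`, where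
`a : K → ℤ` has kernel `H` and `a x = 1`, there is an exact sequence
`0 → Q_n(H) → Q_n(K) → Q_{n-w}(K) → 0` whose second map is `∂_x` (`rank_filteredPoly_eq_add`).
The derivative is onto because binomial coefficients of `a` are polynomials, and its kernel is
`Q_n(H)` because the `x`-invariant extension of a polynomial on `H` to `K` is again a polynomial of
the same degree (`mem_filteredPoly_of_comp`). The numbers of weighted families satisfy the same
recursion (`ncard_weightedFamilies_insert`).
-/

open scoped commutatorElement

/-! ### Left translations and subgroups lowering the degree -/

section Lowering

variable {G : Type*} [Group G]

theorem leftDeriv_apply (u : G) (f : G → ℂ) (x : G) : leftDeriv u f x = f (u * x) - f x := rfl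

theorem leftDeriv_mul (u v : G) (f : G → ℂ) :
    leftDeriv (u * v) f = leftDeriv v (leftDeriv u f) + leftDeriv u f + leftDeriv v f := by
  funext x
  simp only [leftDeriv_apply, Pi.add_apply, mul_assoc]
  ring

theorem leftDeriv_one (f : G → ℂ) : leftDeriv (1 : G) f = 0 := by
  funext x
  simp [leftDeriv_apply]

theorem leftDeriv_mem_of_le {M : ℕ → Submodule ℂ (G → ℂ)} (h0 : M 0 = ⊥) (hM : Monotone M)
    {v : ℕ} {g : G} (hg : ∀ n, ∀ f ∈ M n, leftDeriv g f ∈ M (n - v)) {n m : ℕ} {f : G → ℂ}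
    (hf : f ∈ M n) (hnm : n ≤ m + v) : leftDeriv g f ∈ M m := by
  rcases le_or_gt v n with h | h
  · exact hM (by omega) (hg n f hf)
  · have := hg n f hf
    rw [show n - v = 0 by omega, h0, Submodule.mem_bot] at this
    rw [this]
    exact zero_mem _

/-- For an increasing sequence `M` of spaces of functions with `M 0 = 0`, the subgroup of all `g`
such that the derivative `∂_g` maps every `M n` into `M (n - v)`. -/
def loweringSubgroup (M : ℕ → Submodule ℂ (G → ℂ)) (h0 : M 0 = ⊥) (hM : Monotone M) (v : ℕ)
    (hv : 1 ≤ v) : Subgroup G where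
  carrier := {g | ∀ n, ∀ f ∈ M n, leftDeriv g f ∈ M (n - v)}
  one_mem' n f _ := by
    rw [leftDeriv_one]
    exact zero_mem _
  mul_mem' {a b} ha hb n f hf := by
    rw [leftDeriv_mul]
    exact add_mem (add_mem (hM (Nat.sub_le _ _) (hb _ _ (ha n f hf))) (ha n f hf)) (hb n f hf)
  inv_mem' {a} ha n := by
    induction n using Nat.strong_induction_on with
    | _ n ih =>
      intro f hf
      rcases Nat.eq_zero_or_pos n with rfl | hn
      · rw [h0, Submodule.mem_bot] at hf
        rw [hf, map_zero]
        exact zero_mem _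
      · -- `∂_{a⁻¹} f = -∂_a f - ∂_{a⁻¹} ∂_a f`, and `∂_a f` lies in an earlier space.
        have h := leftDeriv_mul a a⁻¹ f
        rw [mul_inv_cancel, leftDeriv_one] at h
        have h' : leftDeriv a⁻¹ f = -(leftDeriv a⁻¹ (leftDeriv a f) + leftDeriv a f) :=
          (neg_eq_of_add_eq_zero_right h.symm).symm
        rw [h']
        exact neg_mem (add_mem (hM (Nat.sub_le _ _) (ih (n - v) (by omega) _ (ha n f hf)))
          (ha n f hf))

theorem mem_loweringSubgroup {M : ℕ → Submodule ℂ (G → ℂ)} {h0 : M 0 = ⊥} {hM : Monotone M} {v : ℕ}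
    {hv : 1 ≤ v} {g : G} :
    g ∈ loweringSubgroup M h0 hM v hv ↔ ∀ n, ∀ f ∈ M n, leftDeriv g f ∈ M (n - v) := Iff.rfl

theorem loweringSubgroup_anti {M : ℕ → Submodule ℂ (G → ℂ)} {h0 : M 0 = ⊥} {hM : Monotone M}
    {v w : ℕ} {hv : 1 ≤ v} {hw : 1 ≤ w} (h : v ≤ w) :
    loweringSubgroup M h0 hM w hw ≤ loweringSubgroup M h0 hM v hv :=
  fun _ hg n f hf => hM (by omega) (hg n f hf)

theorem commutator_mem_loweringSubgroup {M : ℕ → Submodule ℂ (G → ℂ)} {h0 : M 0 = ⊥}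
    {hM : Monotone M} {i j : ℕ} {hi : 1 ≤ i} {hj : 1 ≤ j} {u v : G}
    (hu : u ∈ loweringSubgroup M h0 hM i hi) (hv : v ∈ loweringSubgroup M h0 hM j hj) :
    ⁅u, v⁆ ∈ loweringSubgroup M h0 hM (i + j) (by omega) := by
  intro n f hf
  -- `∂_⁅u, v⁆` is the commutator of `∂_v` and `∂_u`, followed by the translation by `u⁻¹ * v⁻¹`,
  -- which preserves every `M n`.
  have hu' := loweringSubgroup_anti (hv := le_refl 1) hi (inv_mem hu)
  have hv' := loweringSubgroup_anti (hv := le_refl 1) hj (inv_mem hv)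
  have h := mul_mem hu' hv'
  have key : leftDeriv ⁅u, v⁆ f =
      (leftDeriv (u⁻¹ * v⁻¹) (leftDeriv v (leftDeriv u f) - leftDeriv u (leftDeriv v f)) +
        (leftDeriv v (leftDeriv u f) - leftDeriv u (leftDeriv v f))) := by
    funext x
    simp only [leftDeriv_apply, Pi.add_apply, Pi.sub_apply, commutatorElement_def, mul_assoc,
      mul_inv_cancel_left]
    ring
  have hM' : leftDeriv v (leftDeriv u f) - leftDeriv u (leftDeriv v f) ∈ M (n - (i + j)) := by
    refine sub_mem ?_ ?_
    · have := hv _ _ (hu n f hf)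
      rwa [Nat.sub_sub] at this
    · have := hu _ _ (hv n f hf)
      rwa [Nat.sub_sub, Nat.add_comm] at this
  rw [key]
  exact add_mem (hM (Nat.sub_le _ _) (h _ _ hM')) hM'

/-- If `∂_h` lowers the degree by `w ≥ 1`, then `∂_{h ^ m} ≡ m ∂_h` modulo operators that lower it
by `w + 1`. -/
theorem leftDeriv_pow_sub_mem {M : ℕ → Submodule ℂ (G → ℂ)} {h0 : M 0 = ⊥} {hM : Monotone M}
    {w : ℕ} {hw : 1 ≤ w} {h : G} (hh : h ∈ loweringSubgroup M h0 hM w hw) (m n : ℕ) (f : G → ℂ)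
    (hf : f ∈ M n) : leftDeriv (h ^ m) f - (m : ℂ) • leftDeriv h f ∈ M (n - (w + 1)) := by
  induction m with
  | zero => simp [leftDeriv_one]
  | succ m ih =>
    have e : leftDeriv (h ^ (m + 1)) f - ((m + 1 : ℕ) : ℂ) • leftDeriv h f =
        leftDeriv h (leftDeriv (h ^ m) f) + (leftDeriv (h ^ m) f - (m : ℂ) • leftDeriv h f) := by
      rw [pow_succ, leftDeriv_mul]
      push_cast
      module
    rw [e]
    refine add_mem ?_ ih
    exact hM (by omega) (hh _ _ (pow_mem hh m n f hf))

theorem mem_loweringSubgroup_of_pow_mem {M : ℕ → Submodule ℂ (G → ℂ)} {h0 : M 0 = ⊥}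
    {hM : Monotone M} {v : ℕ} {hv : 1 ≤ v} {h : G} {m : ℕ} (hm : m ≠ 0)
    (h1 : h ∈ loweringSubgroup M h0 hM 1 le_rfl)
    (hh : h ^ m ∈ loweringSubgroup M h0 hM v hv) : h ∈ loweringSubgroup M h0 hM v hv := by
  have H : ∀ w (hw : 1 ≤ w), w ≤ v → h ∈ loweringSubgroup M h0 hM w hw := by
    intro w hw
    induction w, hw using Nat.le_induction with
    | base => exact fun _ => h1
    | succ w hw ih =>
      intro hwv n f hf
      have a := leftDeriv_pow_sub_mem (ih (by omega)) m n f hf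
      have b : leftDeriv (h ^ m) f ∈ M (n - (w + 1)) := hM (by omega) (hh n f hf)
      have c := sub_mem b a
      rw [sub_sub_cancel] at c
      exact (Submodule.smul_mem_iff _ (Nat.cast_ne_zero.mpr hm)).mp c
  exact H v hv le_rfl

end Lowering

/-! ### Polynomials on a filtered group -/

section FilteredPoly

variable {G : Type*} [Group G]

/-- The polynomials of degree `< n` on `G` with respect to a filtration `Γ`: the functions killed
by `∂_{g₁} ⋯ ∂_{gᵣ}` whenever `gᵢ ∈ Γ vᵢ`, `vᵢ ≥ 1` and `∑ vᵢ ≥ n`. The bound on the degree is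
strict, so that the truncated subtraction of `ℕ` gives the right space `0` for negative degrees. -/
def filteredPoly (Γ : ℕ → Subgroup G) : ℕ → Submodule ℂ (G → ℂ)
  | 0 => ⊥
  | n + 1 => ⨅ v : ℕ, ⨅ g : Γ (v + 1), (filteredPoly Γ (n - v)).comap (leftDeriv (g : G))
termination_by n => n

theorem filteredPoly_zero (Γ : ℕ → Subgroup G) : filteredPoly Γ 0 = ⊥ := by rw [filteredPoly]

theorem mem_filteredPoly {Γ : ℕ → Subgroup G} {n : ℕ} (hn : n ≠ 0) {f : G → ℂ} :
    f ∈ filteredPoly Γ n ↔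
      ∀ v, 1 ≤ v → ∀ g ∈ Γ v, leftDeriv g f ∈ filteredPoly Γ (n - v) := by
  obtain ⟨n, rfl⟩ := Nat.exists_eq_succ_of_ne_zero hn
  rw [filteredPoly]
  simp only [Submodule.mem_iInf, Submodule.mem_comap, Subtype.forall]
  constructor
  · intro h v hv g hg
    obtain ⟨v, rfl⟩ : ∃ i, v = i + 1 := ⟨v - 1, by omega⟩
    have := h v g hg
    rwa [show n + 1 - (v + 1) = n - v by omega]
  · intro h v g hg
    have := h (v + 1) (by omega) g hg
    rwa [show n.succ - (v + 1) = n - v by omega] at this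

theorem leftDeriv_mem_filteredPoly {Γ : ℕ → Subgroup G} {n v : ℕ} {f : G → ℂ}
    (hf : f ∈ filteredPoly Γ n) (hv : 1 ≤ v) {g : G} (hg : g ∈ Γ v) :
    leftDeriv g f ∈ filteredPoly Γ (n - v) := by
  rcases Nat.eq_zero_or_pos n with rfl | hn
  · rw [filteredPoly_zero, Submodule.mem_bot] at hf
    rw [hf, map_zero]
    exact zero_mem _
  · exact (mem_filteredPoly hn.ne').mp hf v hv g hg

/-- `filteredPoly Γ` contains every sequence of spaces, starting with `0`, on which the elements
of `Γ v` lower the degree by `v`. -/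
theorem le_filteredPoly {Γ : ℕ → Subgroup G} {M : ℕ → Submodule ℂ (G → ℂ)} (h0 : M 0 = ⊥)
    (h : ∀ v, 1 ≤ v → ∀ g ∈ Γ v, ∀ n, ∀ f ∈ M n, leftDeriv g f ∈ M (n - v)) (n : ℕ) :
    M n ≤ filteredPoly Γ n := by
  induction n using Nat.strong_induction_on with
  | _ n ih =>
    rcases Nat.eq_zero_or_pos n with rfl | hn
    · rw [h0]
      exact bot_le
    · intro f hf
      rw [mem_filteredPoly hn.ne']
      exact fun v hv g hg => ih _ (by omega) (h v hv g hg n f hf)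

theorem filteredPoly_mono (Γ : ℕ → Subgroup G) : Monotone (filteredPoly Γ) := by
  refine monotone_nat_of_le_succ fun n => ?_
  induction n using Nat.strong_induction_on with
  | _ n ih =>
    intro f hf
    rw [mem_filteredPoly (Nat.succ_ne_zero n)]
    intro v hv g hg
    have h1 := leftDeriv_mem_filteredPoly hf hv hg
    rcases le_or_gt v n with h | h
    · rw [show n + 1 - v = n - v + 1 by omega]
      exact ih (n - v) (by omega) h1
    · rwa [show n + 1 - v = n - v by omega]

theorem le_loweringSubgroup_filteredPoly (Γ : ℕ → Subgroup G) (v : ℕ) (hv : 1 ≤ v) :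
    Γ v ≤ loweringSubgroup (filteredPoly Γ) (filteredPoly_zero Γ) (filteredPoly_mono Γ) v hv :=
  fun _ hg _ _ hf => leftDeriv_mem_filteredPoly hf hv hg

theorem leftDeriv_mem_filteredPoly_of_le {Γ : ℕ → Subgroup G} {n m v : ℕ} {f : G → ℂ}
    (hf : f ∈ filteredPoly Γ n) (hv : 1 ≤ v) {g : G} (hg : g ∈ Γ v) (h : n ≤ m + v) :
    leftDeriv g f ∈ filteredPoly Γ m :=
  leftDeriv_mem_of_le (filteredPoly_zero Γ) (filteredPoly_mono Γ)
    (le_loweringSubgroup_filteredPoly Γ v hv hg) hf h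

theorem comp_mem_filteredPoly_comap {H : Type*} [Group H] (ι : H →* G) {Γ : ℕ → Subgroup G}
    (n : ℕ) {f : G → ℂ} (hf : f ∈ filteredPoly Γ n) :
    f ∘ ι ∈ filteredPoly (fun v => (Γ v).comap ι) n := by
  induction n using Nat.strong_induction_on generalizing f with
  | _ n ih =>
    rcases Nat.eq_zero_or_pos n with rfl | hn
    · rw [filteredPoly_zero, Submodule.mem_bot] at hf ⊢
      rw [hf]
      rfl
    · rw [mem_filteredPoly hn.ne']
      intro v hv g hg
      have e : leftDeriv g (f ∘ ι) = leftDeriv (ι g) f ∘ ι := by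
        funext y
        simp [leftDeriv_apply]
      rw [e]
      exact ih _ (by omega) (leftDeriv_mem_filteredPoly hf hv hg)

end FilteredPoly

/-! ### Extending polynomials along an infinite cyclic quotient -/

section Extension

variable {G H : Type*} [Group G] [Group H]

/-- Functions `f` on `G` whose derivatives `∂_x ^ l f`, for `l ≤ i`, restrict to polynomials of
degree `< n - l * w` on all cosets `x ^ b * H`, where the coset is identified with `H` by means of
`ι : H →* G`. -/
def layer (ι : H →* G) (Γ : ℕ → Subgroup G) (w : ℕ) (x : G) : ℕ → ℕ → Submodule ℂ (G → ℂ)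
  | 0, n => ⨅ b : ℤ, (filteredPoly (fun v => (Γ v).comap ι) n).comap
      (LinearMap.funLeft ℂ ℂ fun h => x ^ b * ι h)
  | i + 1, n => layer ι Γ w x 0 n ⊓ (layer ι Γ w x i (n - w)).comap (leftDeriv x)

variable {ι : H →* G} {Γ : ℕ → Subgroup G} {w : ℕ} {x : G}

theorem mem_layer_zero {n : ℕ} {f : G → ℂ} : f ∈ layer ι Γ w x 0 n ↔
    ∀ b : ℤ, (fun h => f (x ^ b * ι h)) ∈ filteredPoly (fun v => (Γ v).comap ι) n := by
  simp only [layer, Submodule.mem_iInf, Submodule.mem_comap]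
  rfl

theorem mem_layer_succ {i n : ℕ} {f : G → ℂ} : f ∈ layer ι Γ w x (i + 1) n ↔
    f ∈ layer ι Γ w x 0 n ∧ leftDeriv x f ∈ layer ι Γ w x i (n - w) := by
  conv_lhs => rw [layer, Submodule.mem_inf, Submodule.mem_comap]

theorem layer_mono (i : ℕ) : Monotone (layer ι Γ w x i) := by
  induction i with
  | zero =>
    intro n m hnm f hf
    rw [mem_layer_zero] at hf ⊢
    exact fun b => filteredPoly_mono _ hnm (hf b)
  | succ i ih =>
    intro n m hnm f hf
    rw [mem_layer_succ] at hf ⊢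
    refine ⟨?_, ih (Nat.sub_le_sub_right hnm w) hf.2⟩
    rw [mem_layer_zero] at hf ⊢
    exact fun b => filteredPoly_mono _ hnm (hf.1 b)

theorem layer_succ_le (i n : ℕ) : layer ι Γ w x (i + 1) n ≤ layer ι Γ w x i n := by
  induction i generalizing n with
  | zero => exact fun f hf => (mem_layer_succ.mp hf).1
  | succ i ih =>
    intro f hf
    rw [mem_layer_succ] at hf ⊢
    exact ⟨hf.1, ih _ hf.2⟩

theorem leftDeriv_mem_layer [hN : ∀ v, (Γ v).Normal]
    (hΓ : ∀ i j, 1 ≤ i → 1 ≤ j → ∀ u ∈ Γ i, ∀ v ∈ Γ j, ⁅u, v⁆ ∈ Γ (i + j))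
    (hw : 1 ≤ w) (hx : x ∈ Γ w) (hι : ∀ (g : G) (h : H), ∃ h', ι h' = g * ι h * g⁻¹)
    (i n v : ℕ) (hv : 1 ≤ v) (h : H) (hh : ι h ∈ Γ v) {f : G → ℂ} (hf : f ∈ layer ι Γ w x i n) :
    leftDeriv (ι h) f ∈ layer ι Γ w x i (n - v) := by
  have h00 : ∀ (n v : ℕ), 1 ≤ v → ∀ h : H, ι h ∈ Γ v → ∀ f ∈ layer ι Γ w x 0 n,
      leftDeriv (ι h) f ∈ layer ι Γ w x 0 (n - v) := by
    intro n v hv h hh f hf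
    rw [mem_layer_zero] at hf ⊢
    intro b
    obtain ⟨h', e⟩ := hι (x ^ b)⁻¹ h
    have hh' : h' ∈ (Γ v).comap ι := by
      rw [Subgroup.mem_comap, e]
      exact (hN v).conj_mem _ hh _
    have := leftDeriv_mem_filteredPoly (Γ := fun v => (Γ v).comap ι) (hf b) hv hh'
    convert this using 1
    funext y
    simp only [leftDeriv_apply, map_mul, e]
    group
  induction i generalizing n v h f with
  | zero => exact h00 n v hv h hh f hf
  | succ i ih =>
    have hf' := mem_layer_succ.mp hf
    rw [mem_layer_succ]
    refine ⟨h00 n v hv h hh f hf'.1, ?_⟩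
    have hfi := layer_succ_le i n hf
    obtain ⟨h₁, e₁⟩ := hι x⁻¹ h
    have hh₁ : ι h₁ ∈ Γ v := by
      rw [e₁]
      exact (hN v).conj_mem _ hh _
    have e₂ : ι (h₁ * h⁻¹) = ⁅x⁻¹, ι h⁆ := by
      rw [map_mul, map_inv, e₁, commutatorElement_def]
    have hh₂ : ι (h₁ * h⁻¹) ∈ Γ (v + w) := by
      rw [e₂, Nat.add_comm]
      exact hΓ w v hw hv _ (inv_mem hx) _ hh
    -- With `x⁻¹ h x = c h` and `c ∈ Γ (v + w)`, the operators `∂_x` and `∂_h` commute up to `∂_c`.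
    have key : leftDeriv x (leftDeriv (ι h) f) = leftDeriv (ι h₁) (leftDeriv x f) +
        leftDeriv (ι (h₁ * h⁻¹)) f + leftDeriv (ι h) (leftDeriv (ι (h₁ * h⁻¹)) f) := by
      funext y
      simp only [leftDeriv_apply, Pi.add_apply, map_mul, map_inv, e₁, mul_assoc, inv_inv,
        inv_mul_cancel_left, mul_inv_cancel_left]
      ring
    rw [key]
    refine add_mem (add_mem ?_ ?_) ?_
    · rw [show n - v - w = n - w - v by omega]
      exact ih _ v hv h₁ hh₁ hf'.2
    · rw [Nat.sub_sub]
      exact ih n (v + w) (by omega) _ hh₂ hfi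
    · rw [Nat.sub_sub]
      exact layer_mono i (Nat.sub_le _ v) (ih _ v hv h hh (ih n (v + w) (by omega) _ hh₂ hfi))

theorem exists_eq_zpow_mul {a : G →* Multiplicative ℤ} (hax : a x = Multiplicative.ofAdd 1)
    (haι : a.ker = ι.range) (g : G) : ∃ h : H, g = x ^ (a g).toAdd * ι h := by
  have : (x ^ (a g).toAdd)⁻¹ * g ∈ ι.range := by
    rw [← haι, MonoidHom.mem_ker, map_mul, map_inv, map_zpow, hax, inv_mul_eq_one, ← ofAdd_zsmul]
    simp
  obtain ⟨h, e⟩ := this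
  exact ⟨h, by rw [e, mul_inv_cancel_left]⟩

theorem apply_zpow_mul_of_leftDeriv_eq_zero {f : G → ℂ} (hf : leftDeriv x f = 0) (b : ℤ) (y : G) :
    f (x ^ b * y) = f y := by
  have h1 : ∀ y, f (x * y) = f y := fun y => sub_eq_zero.mp (congrFun hf y)
  induction b with
  | zero => simp
  | succ b ih => rw [add_comm, zpow_add, zpow_one, mul_assoc, h1, ih]
  | pred b ih => rw [← ih, ← h1, ← mul_assoc, ← zpow_one_add]; congr 3; ring

/-- A function on `G` that is invariant under left translation by `x` and restricts to a polynomial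
on `H` is a polynomial of the same degree on `G`. Its restrictions to the cosets `x ^ b * H` are all
equal, so it lies in every `layer`, and the layers are mapped into each other by the derivatives. -/
theorem mem_filteredPoly_of_comp [hN : ∀ v, (Γ v).Normal] (hanti : Antitone Γ)
    (hΓ : ∀ i j, 1 ≤ i → 1 ≤ j → ∀ u ∈ Γ i, ∀ v ∈ Γ j, ⁅u, v⁆ ∈ Γ (i + j))
    (hw : 1 ≤ w) (hΓw : Γ w = ⊤) (a : G →* Multiplicative ℤ) (hax : a x = Multiplicative.ofAdd 1)
    (haι : a.ker = ι.range) (hΓa : Γ (w + 1) ≤ a.ker) {n : ℕ} {f : G → ℂ}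
    (hfx : leftDeriv x f = 0) (hf : f ∘ ι ∈ filteredPoly (fun v => (Γ v).comap ι) n) :
    f ∈ filteredPoly Γ n := by
  have hx : x ∈ Γ w := hΓw ▸ Subgroup.mem_top x
  have hι : ∀ (g : G) (h : H), ∃ h', ι h' = g * ι h * g⁻¹ := by
    intro g h
    have : g * ι h * g⁻¹ ∈ ι.range := by
      rw [← haι]
      refine (MonoidHom.normal_ker a).conj_mem _ ?_ _
      rw [haι]
      exact ⟨h, rfl⟩
    exact this
  have hdec : ∀ g : G, ∃ (b : ℤ) (h : H), g = x ^ b * ι h :=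
    fun g => ⟨_, exists_eq_zpow_mul hax haι g⟩
  let M : ℕ → Submodule ℂ (G → ℂ) := fun n => ⨅ i, layer ι Γ w x i n
  have hM : Monotone M := fun n m hnm => iInf_mono fun i => layer_mono i hnm
  have hM0 : M 0 = ⊥ := by
    rw [eq_bot_iff]
    intro f hf
    have := (Submodule.mem_iInf _).mp hf 0
    rw [mem_layer_zero] at this
    rw [Submodule.mem_bot]
    funext g
    obtain ⟨b, h, rfl⟩ := hdec g
    have h1 := this b
    rw [filteredPoly_zero, Submodule.mem_bot] at h1
    exact congrFun h1 h
  have hxM : x ∈ loweringSubgroup M hM0 hM w hw := by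
    intro n f hf
    refine (Submodule.mem_iInf _).mpr fun i => ?_
    exact (mem_layer_succ.mp ((Submodule.mem_iInf _).mp hf (i + 1))).2
  have hιM : ∀ v (hv : 1 ≤ v) h, ι h ∈ Γ v → ι h ∈ loweringSubgroup M hM0 hM v hv := by
    intro v hv h hh n f hf
    refine (Submodule.mem_iInf _).mpr fun i => ?_
    exact leftDeriv_mem_layer hΓ hw hx hι i n v hv h hh ((Submodule.mem_iInf _).mp hf i)
  refine le_filteredPoly (M := M) hM0 ?_ n ?_
  · intro v hv g hg
    suffices g ∈ loweringSubgroup M hM0 hM v hv from this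
    rcases le_or_gt v w with h | h
    · obtain ⟨b, y, rfl⟩ := hdec g
      have hv' : Γ v = ⊤ := top_le_iff.mp (hΓw ▸ hanti h)
      exact mul_mem (zpow_mem (loweringSubgroup_anti h hxM) b)
        (hιM v hv y (hv' ▸ Subgroup.mem_top _))
    · have : g ∈ ι.range := haι ▸ hΓa (hanti h hg)
      obtain ⟨y, rfl⟩ := this
      exact hιM v hv y hg
  · have h0 : f ∈ layer ι Γ w x 0 n := by
      rw [mem_layer_zero]
      intro b
      simp only [apply_zpow_mul_of_leftDeriv_eq_zero hfx]
      exact hf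
    refine (Submodule.mem_iInf _).mpr fun i => ?_
    cases i with
    | zero => exact h0
    | succ i => exact mem_layer_succ.mpr ⟨h0, hfx ▸ zero_mem _⟩

end Extension

/-! ### Dimensions along an infinite cyclic quotient -/

/-- The binomial coefficient `z (z - 1) ⋯ (z - r + 1) / r!` as a function of `z : ℂ`. -/
noncomputable def binomialFun : ℕ → ℂ → ℂ
  | 0, _ => 1
  | r + 1, z => binomialFun r z * (z - r) / (r + 1)

theorem binomialFun_succ_add_one (r : ℕ) (z : ℂ) :
    binomialFun (r + 1) (z + 1) = binomialFun (r + 1) z + binomialFun r z := by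
  induction r with
  | zero => simp [binomialFun]
  | succ r ih =>
    have h1 : (r : ℂ) + 1 ≠ 0 := Nat.cast_add_one_ne_zero r
    have h2 : (r : ℂ) + 1 + 1 ≠ 0 := by exact_mod_cast Nat.succ_ne_zero (r + 1)
    rw [binomialFun, ih]
    conv_rhs => rw [binomialFun]
    simp only [binomialFun]
    push_cast
    field_simp
    ring

section Dimension

variable {G : Type*} [Group G] {Γ : ℕ → Subgroup G} {w : ℕ} {x : G} {a : G →* Multiplicative ℤ}

theorem hom_mul_mem_filteredPoly (hanti : Antitone Γ) (hΓa : Γ (w + 1) ≤ a.ker)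
    {n : ℕ} {f : G → ℂ} (hf : f ∈ filteredPoly Γ n) :
    (fun g => ((a g).toAdd : ℂ) * f g) ∈ filteredPoly Γ (n + w) := by
  induction n using Nat.strong_induction_on generalizing f with
  | _ n ih =>
    rcases Nat.eq_zero_or_pos n with rfl | hn
    · rw [filteredPoly_zero, Submodule.mem_bot] at hf
      subst hf
      simp only [Pi.zero_apply, mul_zero]
      exact zero_mem _
    · rw [mem_filteredPoly (by omega)]
      intro v hv g hg
      have e : leftDeriv g (fun g => ((a g).toAdd : ℂ) * f g) =
          (fun y => ((a y).toAdd : ℂ) * leftDeriv g f y) + ((a g).toAdd : ℂ) •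
            (leftDeriv g f + f) := by
        funext y
        simp only [leftDeriv_apply, Pi.add_apply, Pi.smul_apply, map_mul, toAdd_mul, smul_eq_mul]
        push_cast
        ring
      rw [e]
      have hg' := leftDeriv_mem_filteredPoly hf hv hg
      refine add_mem ?_ ?_
      · rcases le_or_gt v n with h | h
        · rw [show n + w - v = n - v + w by omega]
          exact ih _ (by omega) hg'
        · rw [show n - v = 0 by omega, filteredPoly_zero, Submodule.mem_bot] at hg'
          rw [hg']
          simp only [Pi.zero_apply, mul_zero]
          exact zero_mem _
      · rcases le_or_gt v w with h | h
        · exact Submodule.smul_mem _ _ (filteredPoly_mono Γ (by omega)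
            (add_mem (filteredPoly_mono Γ (Nat.sub_le n v) hg') hf))
        · have : a g = 1 := hΓa (hanti h hg)
          simp [this]

theorem binomialFun_mul_mem_filteredPoly (hanti : Antitone Γ)
    (hΓa : Γ (w + 1) ≤ a.ker) (r : ℕ) {n : ℕ} {f : G → ℂ} (hf : f ∈ filteredPoly Γ n) :
    (fun g => binomialFun r (a g).toAdd * f g) ∈ filteredPoly Γ (n + r * w) := by
  induction r with
  | zero => simpa [binomialFun] using hf
  | succ r ih =>
    have h1 := hom_mul_mem_filteredPoly hanti hΓa ih
    have h2 := Submodule.smul_mem _ (r : ℂ) ih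
    have h3 := Submodule.smul_mem _ ((r : ℂ) + 1)⁻¹
      (sub_mem h1 (filteredPoly_mono Γ (Nat.le_add_right _ w) h2))
    rw [show n + (r + 1) * w = n + r * w + w by ring]
    convert h3 using 1
    funext g
    simp only [binomialFun, Pi.smul_apply, Pi.sub_apply, smul_eq_mul]
    ring

theorem leftDeriv_iterate_mem_filteredPoly (hw : 1 ≤ w) (hx : x ∈ Γ w) {n : ℕ} {f : G → ℂ}
    (hf : f ∈ filteredPoly Γ n) (r : ℕ) : (leftDeriv x ^ r) f ∈ filteredPoly Γ (n - r * w) := by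
  induction r with
  | zero => simpa using hf
  | succ r ih =>
    rw [pow_succ', Module.End.mul_apply, show n - (r + 1) * w = n - r * w - w by
      rw [Nat.sub_sub]; congr 1; ring]
    exact leftDeriv_mem_filteredPoly ih hw hx

/-- The difference equation `∂_x f = g` has a polynomial solution `f`. The top coefficient
`u = ∂_x ^ r g` of `g` along `x` is removed by means of `f = binom(a, r + 1) u`. -/
theorem exists_leftDeriv_eq (hanti : Antitone Γ) (hw : 1 ≤ w) (hΓw : Γ w = ⊤)
    (hax : a x = Multiplicative.ofAdd 1) (hΓa : Γ (w + 1) ≤ a.ker) {n : ℕ} {g : G → ℂ}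
    (hg : g ∈ filteredPoly Γ n) : ∃ f ∈ filteredPoly Γ (n + w), leftDeriv x f = g := by
  have hx : x ∈ Γ w := hΓw ▸ Subgroup.mem_top x
  have hD : ∀ (r : ℕ) (u : G → ℂ), leftDeriv x u = 0 →
      leftDeriv x (fun g => binomialFun (r + 1) (a g).toAdd * u g) =
        fun g => binomialFun r (a g).toAdd * u g := by
    intro r u hu
    funext y
    have h1 : u (x * y) = u y := sub_eq_zero.mp (congrFun hu y)
    simp only [leftDeriv_apply, map_mul, hax, toAdd_mul, toAdd_ofAdd, h1]
    push_cast
    rw [add_comm (1 : ℂ), binomialFun_succ_add_one]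
    ring
  have hD' : ∀ (r : ℕ) (u : G → ℂ), leftDeriv x u = 0 →
      (leftDeriv x ^ r) (fun g => binomialFun r (a g).toAdd * u g) = u := by
    intro r u hu
    induction r with
    | zero => simp [binomialFun]
    | succ r ih => rw [pow_succ, Module.End.mul_apply, hD r u hu, ih]
  have main : ∀ (r : ℕ) (g : G → ℂ), g ∈ filteredPoly Γ n → (leftDeriv x ^ r) g = 0 →
      ∃ f ∈ filteredPoly Γ (n + w), leftDeriv x f = g := by
    intro r
    induction r with
    | zero =>
      intro g _ h
      rw [pow_zero, Module.End.one_apply] at h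
      exact ⟨0, zero_mem _, by rw [h, map_zero]⟩
    | succ r ih =>
      intro g hg h
      by_cases hu : (leftDeriv x ^ r) g = 0
      · exact ih g hg hu
      set u := (leftDeriv x ^ r) g with hu_def
      have hxu : leftDeriv x u = 0 := by
        rw [hu_def, ← Module.End.mul_apply, ← pow_succ', h]
      have hum := leftDeriv_iterate_mem_filteredPoly hw hx hg r
      have hrn : r * w < n := by
        by_contra hlt
        rw [show n - r * w = 0 by omega, filteredPoly_zero, Submodule.mem_bot] at hum
        exact hu hum
      have h1 := binomialFun_mul_mem_filteredPoly hanti hΓa r hum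
      have h2 := binomialFun_mul_mem_filteredPoly hanti hΓa (r + 1) hum
      rw [show n - r * w + r * w = n by omega] at h1
      rw [show n - r * w + (r + 1) * w = n + w by rw [add_mul]; omega] at h2
      obtain ⟨f, hf, e⟩ := ih _ (sub_mem hg h1) (by rw [map_sub, hD' r u hxu, sub_self])
      exact ⟨f + _, add_mem hf h2, by rw [map_add, e, hD r u hxu, sub_add_cancel]⟩
  refine main n g hg ?_
  have := leftDeriv_iterate_mem_filteredPoly hw hx hg n
  rwa [Nat.sub_eq_zero_of_le (Nat.le_mul_of_pos_right n hw), filteredPoly_zero,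
    Submodule.mem_bot] at this

end Dimension

/-- The derivative `∂_x` maps the polynomials of degree `< n` on `G` onto those of degree `< n - w`,
and its kernel is identified with the polynomials of degree `< n` on `H` by restriction. -/
theorem rank_filteredPoly_eq_add.{u} {G H : Type u} [Group G] [Group H] {ι : H →* G}
    {Γ : ℕ → Subgroup G} {w : ℕ} {x : G} [hN : ∀ v, (Γ v).Normal] (hanti : Antitone Γ)
    (hΓ : ∀ i j, 1 ≤ i → 1 ≤ j → ∀ u ∈ Γ i, ∀ v ∈ Γ j, ⁅u, v⁆ ∈ Γ (i + j))
    (hw : 1 ≤ w) (hΓw : Γ w = ⊤) (a : G →* Multiplicative ℤ) (hax : a x = Multiplicative.ofAdd 1)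
    (haι : a.ker = ι.range) (hΓa : Γ (w + 1) ≤ a.ker) (hι : Function.Injective ι) (n : ℕ) :
    Module.rank ℂ (filteredPoly Γ n) =
      Module.rank ℂ (filteredPoly Γ (n - w)) +
        Module.rank ℂ (filteredPoly (fun v => (Γ v).comap ι) n) := by
  have hx : x ∈ Γ w := hΓw ▸ Subgroup.mem_top x
  choose ρ hρ using exists_eq_zpow_mul hax haι
  have haι' : ∀ h, a (ι h) = 1 := fun h => by
    rw [← MonoidHom.mem_ker, haι]
    exact ⟨h, rfl⟩
  have hρι : ∀ h, ρ (ι h) = h := fun h => hι (by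
    have := hρ (ι h)
    rw [haι', toAdd_one, zpow_zero, one_mul] at this
    exact this.symm)
  have hρx : ∀ g, ρ (x * g) = ρ g := fun g => hι (by
    have := hρ (x * g)
    rw [map_mul, hax, toAdd_mul, toAdd_ofAdd, zpow_one_add, mul_assoc, mul_right_inj] at this
    conv_lhs at this => rw [hρ g]
    exact (mul_left_cancel this).symm)
  let D : filteredPoly Γ n →ₗ[ℂ] filteredPoly Γ (n - w) :=
    (leftDeriv x).restrict fun f hf => leftDeriv_mem_filteredPoly hf hw hx
  have hD : Function.Surjective D := by
    rintro ⟨g, hg⟩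
    rcases le_or_gt w n with h | h
    · obtain ⟨f, hf, e⟩ := exists_leftDeriv_eq hanti hw hΓw hax hΓa hg
      rw [Nat.sub_add_cancel h] at hf
      exact ⟨⟨f, hf⟩, Subtype.ext e⟩
    · refine ⟨0, Subtype.ext ?_⟩
      rw [Nat.sub_eq_zero_of_le h.le, filteredPoly_zero, Submodule.mem_bot] at hg
      rw [map_zero]
      exact hg.symm
  let R : D.ker →ₗ[ℂ] filteredPoly (fun v => (Γ v).comap ι) n :=
    ((LinearMap.funLeft ℂ ℂ ι).restrict fun f hf => comp_mem_filteredPoly_comap ι n hf) ∘ₗ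
      D.ker.subtype
  have hR : Function.Bijective R := by
    constructor
    · rintro ⟨⟨f, hf⟩, hfD⟩ ⟨⟨f', hf'⟩, hfD'⟩ h
      have hfx : leftDeriv x f = 0 := congrArg Subtype.val hfD
      have hfx' : leftDeriv x f' = 0 := congrArg Subtype.val hfD'
      have h' : f ∘ ι = f' ∘ ι := congrArg Subtype.val h
      refine Subtype.ext (Subtype.ext (funext fun g => ?_))
      change f g = f' g
      rw [hρ g, apply_zpow_mul_of_leftDeriv_eq_zero hfx, apply_zpow_mul_of_leftDeriv_eq_zero hfx']
      exact congrFun h' _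
    · rintro ⟨F, hF⟩
      have hfx : leftDeriv x (F ∘ ρ) = 0 := by
        funext y
        simp [leftDeriv_apply, hρx]
      have hres : (F ∘ ρ) ∘ ι = F := funext fun h => congrArg F (hρι h)
      have hmem : F ∘ ρ ∈ filteredPoly Γ n :=
        mem_filteredPoly_of_comp hanti hΓ hw hΓw a hax haι hΓa hfx (by rwa [hres])
      exact ⟨⟨⟨F ∘ ρ, hmem⟩, Subtype.ext hfx⟩, Subtype.ext hres⟩
  rw [LinearMap.rank_eq_of_surjective hD, (LinearEquiv.ofBijective R hR).rank_eq]

/-! ### Torsion in nilpotent groups -/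

section NilpotentTorsion

open Subgroup

theorem commutatorElement_pow_left_of_mem_center {G : Type*} [Group G] {x y : G}
    (h : ⁅x, y⁆ ∈ center G) (n : ℕ) : ⁅x ^ n, y⁆ = ⁅x, y⁆ ^ n := by
  induction n with
  | zero => simp
  | succ n ih =>
    rw [pow_succ', commutatorElement_mul_left_eq_conj_mul, ih, pow_succ]
    congr 1
    rw [((mem_center_iff.mp (pow_mem h n)) x)]
    group

/-- A nilpotent group with torsion-free centre is torsion-free: the centre of the quotient by the
centre is again torsion-free, because an element that is central modulo the centre has central
commutators, and these depend multiplicatively on it. -/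
theorem eq_one_of_pow_eq_one_of_center {G : Type*} [Group G] [Group.IsNilpotent G]
    (hG : ∀ z ∈ center G, ∀ n : ℕ, n ≠ 0 → z ^ n = 1 → z = 1) (g : G) (n : ℕ) (hn : n ≠ 0)
    (hg : g ^ n = 1) : g = 1 := by
  revert hG g n
  refine Group.nilpotent_center_quotient_ind
    (P := fun G _ _ => (∀ z ∈ center G, ∀ n : ℕ, n ≠ 0 → z ^ n = 1 → z = 1) →
      ∀ (g : G) (n : ℕ), n ≠ 0 → g ^ n = 1 → g = 1) G ?_ ?_
  · intro G _ _ _ g _ _ _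
    exact Subsingleton.elim _ _
  · intro G _ _ ih hG g n hn hg
    refine hG g ?_ n hn hg
    rw [← QuotientGroup.eq_one_iff]
    refine ih ?_ _ n hn (by rw [← QuotientGroup.mk_pow, hg, QuotientGroup.mk_one])
    intro z hz m hm hzm
    induction z using QuotientGroup.induction_on with
    | H x =>
      rw [QuotientGroup.eq_one_iff, mem_center_iff]
      rw [← QuotientGroup.mk_pow, QuotientGroup.eq_one_iff] at hzm
      intro y
      have h1 : ⁅x, y⁆ ∈ center G := by
        rw [← QuotientGroup.eq_one_iff]
        have := mem_center_iff.mp hz (y : G ⧸ center G)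
        rw [commutatorElement_def, QuotientGroup.mk_mul, QuotientGroup.mk_mul,
          QuotientGroup.mk_mul, ← this, QuotientGroup.mk_inv, QuotientGroup.mk_inv]
        group
      have h2 : ⁅x, y⁆ ^ m = 1 := by
        rw [← commutatorElement_pow_left_of_mem_center h1, commutatorElement_eq_one_iff_mul_comm]
        exact (mem_center_iff.mp hzm y).symm
      exact (commutatorElement_eq_one_iff_mul_comm.mp (hG _ h1 m hm h2)).symm

/-- Every group has a largest normal torsion subgroup. -/
theorem exists_largest_normal_torsion (G : Type*) [Group G] : ∃ T : Subgroup G, T.Normal ∧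
    (∀ g ∈ T, ∃ n : ℕ, n ≠ 0 ∧ g ^ n = 1) ∧
    ∀ N : Subgroup G, N.Normal → (∀ g ∈ N, ∃ n : ℕ, n ≠ 0 ∧ g ^ n = 1) → N ≤ T := by
  let S : Set (Subgroup G) := {N | N.Normal ∧ ∀ g ∈ N, ∃ n : ℕ, n ≠ 0 ∧ g ^ n = 1}
  have hne : S.Nonempty := ⟨⊥, inferInstance, fun g hg => ⟨1, one_ne_zero, by
    rw [mem_bot.mp hg, one_pow]⟩⟩
  have hdir : DirectedOn (· ≤ ·) S := by
    rintro A ⟨hA, hA'⟩ B ⟨hB, hB'⟩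
    refine ⟨A ⊔ B, ⟨inferInstance, ?_⟩, le_sup_left, le_sup_right⟩
    intro g hg
    obtain ⟨a, ha, b, hb, rfl⟩ := mem_sup_of_normal_right.mp hg
    obtain ⟨m, hm, hbm⟩ := hB' b hb
    have h1 : (a * b) ^ m ∈ A := by
      rw [← QuotientGroup.eq_one_iff, QuotientGroup.mk_pow, QuotientGroup.mk_mul,
        (QuotientGroup.eq_one_iff a).mpr ha, one_mul, ← QuotientGroup.mk_pow, hbm,
        QuotientGroup.mk_one]
    obtain ⟨k, hk, e⟩ := hA' _ h1
    exact ⟨m * k, mul_ne_zero hm hk, by rw [pow_mul, e]⟩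
  refine ⟨sSup S, sSup_normal S fun N hN => hN.1, ?_, fun N hN hN' => le_sSup ⟨hN, hN'⟩⟩
  intro g hg
  obtain ⟨N, hN, hgN⟩ := (mem_sSup_of_directedOn hne hdir).mp hg
  exact hN.2 g hgN

theorem exists_pow_mul_eq_one {G : Type*} [Group G] [Group.IsNilpotent G] {x y : G}
    (hx : ∃ n : ℕ, n ≠ 0 ∧ x ^ n = 1) (hy : ∃ n : ℕ, n ≠ 0 ∧ y ^ n = 1) :
    ∃ n : ℕ, n ≠ 0 ∧ (x * y) ^ n = 1 := by
  obtain ⟨T, hT, hT', hmax⟩ := exists_largest_normal_torsion G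
  -- The quotient by `T` has torsion-free centre, so `T` contains all torsion elements.
  have hfree : ∀ (g : G ⧸ T) (n : ℕ), n ≠ 0 → g ^ n = 1 → g = 1 := by
    refine eq_one_of_pow_eq_one_of_center ?_
    intro z hz n hn hzn
    have hZ : (zpowers z).Normal := ⟨fun a ha g => by
      have : a ∈ center (G ⧸ T) := (zpowers_le.mpr hz) ha
      rwa [mem_center_iff.mp this g, mul_inv_cancel_right]⟩
    have hle := hmax ((zpowers z).comap (QuotientGroup.mk' T)) inferInstance (by
      rintro g ⟨k, hk⟩
      have h1 : g ^ n ∈ T := by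
        rw [← QuotientGroup.eq_one_iff, QuotientGroup.mk_pow]
        change (QuotientGroup.mk' T g) ^ n = 1
        rw [← hk]
        change (z ^ k) ^ n = 1
        rw [← zpow_natCast, zpow_comm, zpow_natCast, hzn, one_zpow]
      obtain ⟨m, hm, e⟩ := hT' _ h1
      exact ⟨n * m, mul_ne_zero hn hm, by rw [pow_mul, e]⟩)
    obtain ⟨g, rfl⟩ := QuotientGroup.mk_surjective z
    exact (QuotientGroup.eq_one_iff g).mpr (hle (mem_zpowers _))
  have hmem : ∀ g : G, (∃ n : ℕ, n ≠ 0 ∧ g ^ n = 1) → g ∈ T := by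
    rintro g ⟨n, hn, e⟩
    rw [← QuotientGroup.eq_one_iff]
    exact hfree _ n hn (by rw [← QuotientGroup.mk_pow, e, QuotientGroup.mk_one])
  exact hT' _ (mul_mem (hmem x hx) (hmem y hy))

theorem commute_of_commute_pow_left {G : Type*} [Group G] [Group.IsNilpotent G]
    (hG : ∀ (g : G) (n : ℕ), n ≠ 0 → g ^ n = 1 → g = 1) {x y : G} {m : ℕ} (hm : m ≠ 0)
    (h : Commute (x ^ m) y) : Commute x y := by
  obtain ⟨c, hc⟩ := Group.IsNilpotent.nilpotent G
  have key : ∀ i, ∀ y ∈ Subgroup.upperCentralSeries G i, Commute (x ^ m) y → Commute x y := by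
    intro i
    induction i with
    | zero =>
      intro y hy _
      rw [Subgroup.upperCentralSeries_zero, mem_bot] at hy
      rw [hy]
      exact Commute.one_right x
    | succ i ih =>
      intro y hy h
      -- `z` commutes with `x ^ m`, hence with `x`, and then `z ^ m = ⁅y, x ^ m⁆ = 1`.
      set z := y * x * y⁻¹ * x⁻¹ with hz
      have hzi : z ∈ Subgroup.upperCentralSeries G i :=
        Subgroup.mem_upperCentralSeries_succ_iff.mp hy x
      have hconj : (y * x * y⁻¹) ^ m = x ^ m := by
        rw [conj_pow, ← h.eq, mul_inv_cancel_right]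
      have h1 : Commute (x ^ m) z := by
        refine Commute.mul_right ?_ ((Commute.refl x).pow_left m).inv_right
        rw [← hconj]
        exact (Commute.refl _).pow_left m
      have h2 : Commute z x := (ih z hzi h1).symm
      have h3 : z ^ m = 1 := by
        have : z * x = y * x * y⁻¹ := by rw [hz, inv_mul_cancel_right]
        rw [← this, h2.mul_pow] at hconj
        exact mul_eq_right.mp hconj
      have h4 := hG z m hm h3
      rw [hz, mul_inv_eq_one, mul_inv_eq_iff_eq_mul] at h4
      exact h4.symm
  exact key c y (hc ▸ mem_top y) h

end NilpotentTorsion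

/-! ### The isolators of the lower central series -/

section Isolator

open Subgroup

theorem commutator_commutator_le_of_rotate {G : Type*} [Group G] {A B C N : Subgroup G} [N.Normal]
    (h1 : ⁅⁅B, C⁆, A⁆ ≤ N) (h2 : ⁅⁅C, A⁆, B⁆ ≤ N) : ⁅⁅A, B⁆, C⁆ ≤ N := by
  have e : ∀ K : Subgroup G, K ≤ N ↔ K.map (QuotientGroup.mk' N) = ⊥ := fun K => by
    rw [Subgroup.map_eq_bot_iff, QuotientGroup.ker_mk']
  rw [e, map_commutator, map_commutator] at h1 h2 ⊢
  exact commutator_commutator_eq_bot_of_rotate h1 h2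

variable {G : Type*} [Group G]

theorem lowerCentralTerm_antitone : Antitone (lowerCentralTerm G) :=
  fun _ _ h => Subgroup.lowerCentralSeries_antitone ⊤ (Nat.sub_le_sub_right h 1)

theorem commutator_lowerCentralTerm_le {i j : ℕ} (hi : 1 ≤ i) (hj : 1 ≤ j) :
    ⁅lowerCentralTerm G i, lowerCentralTerm G j⁆ ≤ lowerCentralTerm G (i + j) := by
  induction i, hi using Nat.le_induction generalizing j with
  | base => rw [← lowerCentralTerm_succ G j hj, add_comm]
  | succ i hi ih =>
    rw [lowerCentralTerm_succ G i hi]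
    refine commutator_commutator_le_of_rotate ?_ ?_
    · rw [commutator_comm, commutator_comm (lowerCentralTerm G i)]
      refine (commutator_mono le_rfl ((commutator_comm _ _).le.trans (ih hj))).trans ?_
      rw [← lowerCentralTerm_succ G _ (by omega), show i + j + 1 = i + 1 + j by ring]
    · rw [commutator_comm, commutator_comm (lowerCentralTerm G j), ← lowerCentralTerm_succ G j hj]
      exact (ih (by omega)).trans_eq (congrArg _ (by ring))

instance isNilpotent_quotient_lowerCentralTerm (j : ℕ) :
    Group.IsNilpotent (G ⧸ lowerCentralTerm G j) := by
  rw [Subgroup.nilpotent_iff_lowerCentralSeries]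
  refine ⟨j - 1, ?_⟩
  have h := Subgroup.map_lowerCentralSeries (⊤ : Subgroup G)
    (QuotientGroup.mk' (lowerCentralTerm G j)) (j - 1)
  rw [map_top_of_surjective _ (QuotientGroup.mk'_surjective _)] at h
  rw [← h, Subgroup.map_eq_bot_iff, QuotientGroup.ker_mk']
  rfl

variable (G) in
/-- The isolator of `G_j`: all elements with a nontrivial power in `G_j`. -/
def lowerCentralIsolator (j : ℕ) : Subgroup G where
  carrier := {g | ∃ n : ℕ, n ≠ 0 ∧ g ^ n ∈ lowerCentralTerm G j}
  one_mem' := ⟨1, one_ne_zero, by rw [one_pow]; exact one_mem _⟩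
  inv_mem' := by
    rintro g ⟨n, hn, h⟩
    exact ⟨n, hn, by rw [inv_pow]; exact inv_mem h⟩
  mul_mem' := by
    intro x y hx hy
    simp only [Set.mem_ofPred_eq, ← QuotientGroup.eq_one_iff, QuotientGroup.mk_pow,
      QuotientGroup.mk_mul] at hx hy ⊢
    exact exists_pow_mul_eq_one hx hy

theorem mem_lowerCentralIsolator {j : ℕ} {g : G} :
    g ∈ lowerCentralIsolator G j ↔ ∃ n : ℕ, n ≠ 0 ∧ g ^ n ∈ lowerCentralTerm G j := Iff.rfl

theorem lowerCentralTerm_le_isolator (j : ℕ) : lowerCentralTerm G j ≤ lowerCentralIsolator G j :=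
  fun g hg => ⟨1, one_ne_zero, by rwa [pow_one]⟩

theorem lowerCentralIsolator_antitone : Antitone (lowerCentralIsolator G) :=
  fun _ _ h _ ⟨n, hn, hg⟩ => ⟨n, hn, lowerCentralTerm_antitone h hg⟩

theorem lowerCentralIsolator_one : lowerCentralIsolator G 1 = ⊤ :=
  top_le_iff.mp (lowerCentralTerm_le_isolator 1)

theorem mem_lowerCentralIsolator_of_pow_mem {j : ℕ} {g : G} {n : ℕ} (hn : n ≠ 0)
    (h : g ^ n ∈ lowerCentralIsolator G j) : g ∈ lowerCentralIsolator G j := by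
  obtain ⟨m, hm, h⟩ := h
  exact ⟨n * m, mul_ne_zero hn hm, by rwa [pow_mul]⟩

instance lowerCentralIsolator_normal (j : ℕ) : (lowerCentralIsolator G j).Normal :=
  ⟨fun a ⟨n, hn, h⟩ g => ⟨n, hn, by
    rw [conj_pow]
    exact (lowerCentralTerm_normal G j).conj_mem _ h g⟩⟩

theorem commutator_mem_lowerCentralIsolator (i j : ℕ) (hi : 1 ≤ i) (hj : 1 ≤ j) (x : G)
    (hx : x ∈ lowerCentralIsolator G i) (y : G) (hy : y ∈ lowerCentralIsolator G j) :
    ⁅x, y⁆ ∈ lowerCentralIsolator G (i + j) := by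
  obtain ⟨m, hm, hx⟩ := hx
  obtain ⟨n, hn, hy⟩ := hy
  set T := lowerCentralIsolator G (i + j) with hT
  have hle : lowerCentralTerm G (i + j) ≤ T := lowerCentralTerm_le_isolator _
  have : Group.IsNilpotent (G ⧸ T) := Group.nilpotent_of_surjective
    (QuotientGroup.map (lowerCentralTerm G (i + j)) T (MonoidHom.id G) hle)
    (QuotientGroup.map_surjective_of_surjective _ _ _ (QuotientGroup.mk_surjective) _)
  have hfree : ∀ (g : G ⧸ T) (n : ℕ), n ≠ 0 → g ^ n = 1 → g = 1 := by
    intro g n hn h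
    induction g using QuotientGroup.induction_on with
    | H g =>
      rw [← QuotientGroup.mk_pow, QuotientGroup.eq_one_iff] at h
      exact (QuotientGroup.eq_one_iff g).mpr (mem_lowerCentralIsolator_of_pow_mem hn h)
  have hc : Commute ((x : G ⧸ T) ^ m) ((y : G ⧸ T) ^ n) := by
    rw [← commutatorElement_eq_one_iff_commute, ← QuotientGroup.mk_pow, ← QuotientGroup.mk_pow]
    have := hle (commutator_lowerCentralTerm_le hi hj (commutator_mem_commutator hx hy))
    exact (QuotientGroup.eq_one_iff _).mpr this
  have hc' := (commute_of_commute_pow_left hfree hn (commute_of_commute_pow_left hfree hm hc).symm)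
  rw [← QuotientGroup.eq_one_iff]
  exact commutatorElement_eq_one_iff_commute.mpr hc'.symm

end Isolator

/-! ### Finite generation and the ranks of the quotients -/

section FiniteGeneration

open Subgroup

theorem exists_fg_map_eq {P Q : Type*} [Group P] [Group Q] (π : P →* Q) (H : Subgroup P)
    (h : (H.map π).FG) : ∃ K ≤ H, K.FG ∧ K.map π = H.map π := by
  classical
  obtain ⟨S, hS⟩ := h
  have hsub : (S : Set Q) ⊆ π '' (H : Set P) := by
    rw [← coe_map, ← hS]
    exact subset_closure
  obtain ⟨S', hS', rfl⟩ := Finset.subset_set_image_iff.mp hsub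
  refine ⟨closure S', (closure_le H).mpr hS', ⟨S', rfl⟩, ?_⟩
  rw [MonoidHom.map_closure, ← hS, Finset.coe_image]

theorem fg_of_commGroup_fg {Q : Type*} [CommGroup Q] [Group.FG Q] (H : Subgroup Q) : H.FG := by
  have h1 : Module.Finite ℤ (Additive Q) := Module.Finite.iff_addGroup_fg.mpr inferInstance
  have h2 : (AddSubgroup.toIntSubmodule H.toAddSubgroup).FG := IsNoetherian.noetherian _
  rw [Subgroup.fg_iff_add_fg]
  exact (Submodule.fg_iff_addSubgroup_fg _).mp h2

theorem fg_quotient_of_le_sup {G : Type*} [Group G] {A N K : Subgroup G} [N.Normal] (hKA : K ≤ A)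
    (hK : K.FG) (h : A ≤ K ⊔ N) : Group.FG (A ⧸ N.subgroupOf A) := by
  have : Group.FG K := (Group.fg_iff_subgroup_fg K).mpr hK
  refine Group.fg_of_surjective
    (f := (QuotientGroup.mk' (N.subgroupOf A)).comp (Subgroup.inclusion hKA)) ?_
  intro q
  induction q using QuotientGroup.induction_on with
  | H a =>
    obtain ⟨k, hk, n, hn, e⟩ := mem_sup_of_normal_right.mp (h a.2)
    refine ⟨⟨k, hk⟩, ?_⟩
    change ((⟨k, hKA hk⟩ : A) : A ⧸ N.subgroupOf A) = (a : A ⧸ N.subgroupOf A)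
    rw [QuotientGroup.eq, mem_subgroupOf, coe_mul, coe_inv, ← e, inv_mul_cancel_left]
    exact hn

variable {G : Type*} [Group G]

/-- The group `G_j` is finitely generated modulo `G_{j+1}`: if `S` generates `G` and `T` generates
`G_j` modulo `G_{j+1}`, then the commutators `⁅s, t⁆` generate `G_{j+1}` modulo `G_{j+2}`. -/
theorem exists_fg_lowerCentralTerm_le_sup (hG : Group.FG G) (j : ℕ) (hj : 1 ≤ j) :
    ∃ K ≤ lowerCentralTerm G j, K.FG ∧ lowerCentralTerm G j ≤ K ⊔ lowerCentralTerm G (j + 1) := by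
  classical
  induction j, hj using Nat.le_induction with
  | base => exact ⟨⊤, le_rfl, Group.fg_def.mp hG, le_sup_left⟩
  | succ j hj ih =>
    obtain ⟨S, hS⟩ := Group.fg_def.mp hG
    obtain ⟨_, hTle, ⟨T, rfl⟩, hT⟩ := ih
    have hTle' : (T : Set G) ⊆ lowerCentralTerm G j := (closure_le _).mp hTle
    let C : Finset G := Finset.image₂ (fun s t => ⁅s, t⁆) S T
    have hcomm : ∀ {i : ℕ}, 1 ≤ i → ∀ (g : G) {h : G}, h ∈ lowerCentralTerm G i →
        ⁅g, h⁆ ∈ lowerCentralTerm G (i + 1) := by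
      intro i hi g h hh
      rw [lowerCentralTerm_succ G i hi]
      exact commutator_mem_commutator (mem_top g) hh
    have hC : closure (C : Set G) ≤ lowerCentralTerm G (j + 1) := by
      rw [closure_le]
      intro c hc
      obtain ⟨s, -, t, ht, rfl⟩ := Finset.mem_image₂.mp (Finset.mem_coe.mp hc)
      exact hcomm hj s (hTle' ht)
    refine ⟨closure C, hC, ⟨C, rfl⟩, ?_⟩
    set K := closure (C : Set G) ⊔ lowerCentralTerm G (j + 1 + 1) with hK
    have hKle : K ≤ lowerCentralTerm G (j + 1) :=
      sup_le hC (lowerCentralTerm_antitone (Nat.le_succ _))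
    have hKn : K.Normal := ⟨fun k hk g => by
      have h1 := mul_mem (hK ▸ mem_sup_right (hcomm (by omega) g (hKle hk))) hk
      rwa [commutatorElement_def, inv_mul_cancel_right] at h1⟩
    -- Membership of `⁅g, h⁆` in `K` is commutation modulo `K`, so it can be tested on generators.
    have hmem : ∀ g h : G, ⁅g, h⁆ ∈ K ↔ Commute (g : G ⧸ K) (h : G ⧸ K) := by
      intro g h
      rw [← commutatorElement_eq_one_iff_commute, ← QuotientGroup.eq_one_iff]
      rfl
    have h1 : ∀ t ∈ T, ∀ g : G, Commute (g : G ⧸ K) (t : G ⧸ K) := by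
      intro t ht g
      have : (⊤ : Subgroup G) ≤ (centralizer {(t : G ⧸ K)}).comap (QuotientGroup.mk' K) := by
        rw [← hS, closure_le]
        intro s hs
        change (s : G ⧸ K) ∈ centralizer {(t : G ⧸ K)}
        rw [mem_centralizer_singleton_iff]
        exact (hmem s t).mp (hK ▸ mem_sup_left
          (subset_closure (Finset.mem_coe.mpr (Finset.mem_image₂_of_mem hs ht))))
      exact mem_centralizer_singleton_iff.mp (this (mem_top g))
    rw [lowerCentralTerm_succ G j hj, commutator_le]
    intro g _ h hh
    rw [hmem]
    have h2 : closure (T : Set G) ⊔ lowerCentralTerm G (j + 1) ≤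
        (centralizer {(g : G ⧸ K)}).comap (QuotientGroup.mk' K) := by
      refine sup_le ((closure_le _).mpr fun t ht => ?_) fun c hc => ?_
      · change (t : G ⧸ K) ∈ centralizer {(g : G ⧸ K)}
        rw [mem_centralizer_singleton_iff]
        exact (h1 t ht g).symm
      · change (c : G ⧸ K) ∈ centralizer {(g : G ⧸ K)}
        rw [mem_centralizer_singleton_iff]
        exact ((hmem g c).mp (hK ▸ mem_sup_right (hcomm (by omega) g hc))).symm
    exact (mem_centralizer_singleton_iff.mp (h2 (hT hh))).symm

theorem fg_lowerCentralQuotient (hG : Group.FG G) (j : ℕ) (hj : 1 ≤ j) :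
    Group.FG (lowerCentralQuotient G j) := by
  obtain ⟨K, h1, h2, h3⟩ := exists_fg_lowerCentralTerm_le_sup hG j hj
  exact fg_quotient_of_le_sup h1 h2 h3

/-- Every subgroup of `G` is finitely generated modulo `G_j`. -/
theorem exists_fg_le_sup_lowerCentralTerm (hG : Group.FG G) (j : ℕ) (hj : 1 ≤ j) (H : Subgroup G) :
    ∃ K ≤ H, K.FG ∧ H ≤ K ⊔ lowerCentralTerm G j := by
  induction j, hj using Nat.le_induction with
  | base => exact ⟨⊥, bot_le, Subgroup.FG.bot, le_sup_of_le_right le_top⟩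
  | succ j hj ih =>
    obtain ⟨K₁, h1, h2, h3⟩ := ih
    have := fg_lowerCentralQuotient hG j hj
    obtain ⟨K₂, h4, h5, h6⟩ := exists_fg_map_eq
      (QuotientGroup.mk' ((lowerCentralTerm G (j + 1)).subgroupOf (lowerCentralTerm G j)))
      (H.subgroupOf (lowerCentralTerm G j))
      (fg_of_commGroup_fg (Q := lowerCentralQuotient G j) _)
    have h7 : K₂.map (lowerCentralTerm G j).subtype ≤ H := by
      rintro _ ⟨k, hk, rfl⟩
      exact h4 hk
    have h8 : (K₂.map (lowerCentralTerm G j).subtype).FG := by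
      obtain ⟨S, rfl⟩ := h5
      classical
      exact ⟨S.image (lowerCentralTerm G j).subtype, by
        rw [MonoidHom.map_closure, Finset.coe_image]⟩
    refine ⟨K₁ ⊔ K₂.map (lowerCentralTerm G j).subtype, sup_le h1 h7, h2.sup h8, ?_⟩
    intro h hh
    obtain ⟨k, hk, c, hc, rfl⟩ := mem_sup_of_normal_right.mp (h3 hh)
    have hcH : c ∈ H := (mul_mem_cancel_left (h1 hk)).mp hh
    have hc' : (⟨c, hc⟩ : lowerCentralTerm G j) ∈
        K₂ ⊔ (lowerCentralTerm G (j + 1)).subgroupOf (lowerCentralTerm G j) := by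
      have e := comap_map_eq (QuotientGroup.mk' ((lowerCentralTerm G (j + 1)).subgroupOf
        (lowerCentralTerm G j))) K₂
      rw [QuotientGroup.ker_mk', h6] at e
      rw [← e]
      exact mem_map_of_mem _ hcH
    obtain ⟨k', hk', n, hn, e⟩ := mem_sup_of_normal_right.mp hc'
    have e' : (k' : G) * n = c := congrArg Subtype.val e
    rw [← e', ← mul_assoc]
    exact mul_mem_sup (mul_mem_sup hk (mem_map_of_mem _ hk')) hn

/-- A finitely generated torsion-free abelian quotient is free abelian. -/
theorem exists_hom_ker_eq {P : Type*} [Group P] (N : Subgroup P) [N.Normal] [Group.FG (P ⧸ N)]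
    (hcomm : ∀ x y : P, ⁅x, y⁆ ∈ N) (hfree : ∀ (x : P) (n : ℕ), n ≠ 0 → x ^ n ∈ N → x ∈ N) :
    ∃ (r : ℕ) (ψ : P →* Multiplicative (Fin r → ℤ)), Function.Surjective ψ ∧ ψ.ker = N := by
  let _ : CommGroup (P ⧸ N) :=
    { (inferInstance : Group (P ⧸ N)) with
      mul_comm := by
        intro a b
        induction a using QuotientGroup.induction_on with
        | H x =>
          induction b using QuotientGroup.induction_on with
          | H y =>
            rw [← commutatorElement_eq_one_iff_mul_comm]
            exact (QuotientGroup.eq_one_iff _).mpr (hcomm x y) }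
  have htf : IsMulTorsionFree (P ⧸ N) := by
    refine ⟨fun n hn a b hab => ?_⟩
    rw [← div_eq_one]
    replace hab : (a / b) ^ n = 1 := by
      rw [div_pow, div_eq_one]
      exact hab
    generalize a / b = c at hab
    induction c using QuotientGroup.induction_on with
    | H x =>
      rw [← QuotientGroup.mk_pow, QuotientGroup.eq_one_iff] at hab
      exact (QuotientGroup.eq_one_iff x).mpr (hfree x n hn hab)
  have hfin : Module.Finite ℤ (Additive (P ⧸ N)) := Module.Finite.iff_addGroup_fg.mpr inferInstance
  have hfr : Module.Free ℤ (Additive (P ⧸ N)) := inferInstance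
  let e := (Module.finBasis ℤ (Additive (P ⧸ N))).equivFun
  let e' : (P ⧸ N) ≃* Multiplicative (Fin (Module.finrank ℤ (Additive (P ⧸ N))) → ℤ) :=
    e.toAddEquiv.toMultiplicativeRight
  refine ⟨_, e'.toMonoidHom.comp (QuotientGroup.mk' N),
    e'.surjective.comp (QuotientGroup.mk'_surjective N), ?_⟩
  ext x
  rw [MonoidHom.mem_ker]
  change e' (x : P ⧸ N) = 1 ↔ x ∈ N
  rw [EmbeddingLike.map_eq_one_iff, QuotientGroup.eq_one_iff]

/-- The rank of `G_j / G_{j+1}` can be computed from the isolators: a map from the isolator of `G_j`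
onto `ℤ ^ r` whose kernel is the isolator of `G_{j+1}` induces a map from `G_j / G_{j+1}` to `ℤ ^ r`
with torsion kernel and torsion cokernel. -/
theorem lowerCentralRank_eq (j r : ℕ)
    (ψ : lowerCentralIsolator G j →* Multiplicative (Fin r → ℤ)) (hψ : Function.Surjective ψ)
    (hker : ψ.ker = (lowerCentralIsolator G (j + 1)).subgroupOf (lowerCentralIsolator G j)) :
    lowerCentralRank G j = r := by
  have hψ1 : ∀ x, ψ x = 1 ↔ (x : G) ∈ lowerCentralIsolator G (j + 1) := by
    intro x
    rw [← MonoidHom.mem_ker, hker, mem_subgroupOf]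
  let φ : lowerCentralQuotient G j →* Multiplicative (Fin r → ℤ) :=
    QuotientGroup.lift _ (ψ.comp (Subgroup.inclusion (lowerCentralTerm_le_isolator j))) (by
      intro x hx
      exact (hψ1 _).mpr (lowerCentralTerm_le_isolator _ (mem_subgroupOf.mp hx)))
  let θ : Additive (lowerCentralQuotient G j) →ₗ[ℤ] (Fin r → ℤ) :=
    (MonoidHom.toAdditiveLeft φ).toIntLinearMap
  have hθ : ∀ x : lowerCentralTerm G j, θ (Additive.ofMul (x : lowerCentralQuotient G j)) =
      (ψ (Subgroup.inclusion (lowerCentralTerm_le_isolator j) x)).toAdd := fun _ => rfl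
  have hkerθ : θ.ker ≤ Submodule.torsion ℤ (Additive (lowerCentralQuotient G j)) := by
    intro q hq
    obtain ⟨x, rfl⟩ := QuotientGroup.mk_surjective q.toMul
    change θ (Additive.ofMul (x : lowerCentralQuotient G j)) = 0 at hq
    rw [hθ, toAdd_eq_zero, hψ1] at hq
    obtain ⟨m, hm, hx⟩ := hq
    refine (Submodule.mem_torsion_iff _).mpr
      ⟨⟨(m : ℤ), mem_nonZeroDivisors_of_ne_zero (Nat.cast_ne_zero.mpr hm)⟩, ?_⟩
    change (m : ℤ) • Additive.ofMul (x : lowerCentralQuotient G j) = 0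
    rw [natCast_zsmul, ← ofMul_pow, ofMul_eq_zero, ← QuotientGroup.mk_pow]
    exact (QuotientGroup.eq_one_iff _).mpr hx
  have hcoker : Module.IsTorsion ℤ ((Fin r → ℤ) ⧸ LinearMap.range θ) := by
    intro q
    obtain ⟨v, rfl⟩ := Submodule.Quotient.mk_surjective _ q
    obtain ⟨g, hg⟩ := hψ (Multiplicative.ofAdd v)
    obtain ⟨m, hm, hgm⟩ := g.2
    refine ⟨⟨(m : ℤ), mem_nonZeroDivisors_of_ne_zero (Nat.cast_ne_zero.mpr hm)⟩, ?_⟩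
    change (m : ℤ) • Submodule.Quotient.mk v = (0 : (Fin r → ℤ) ⧸ LinearMap.range θ)
    rw [← Submodule.Quotient.mk_smul, Submodule.Quotient.mk_eq_zero]
    refine ⟨Additive.ofMul ((⟨(g : G) ^ m, hgm⟩ : lowerCentralTerm G j) :
      lowerCentralQuotient G j), ?_⟩
    rw [hθ]
    have : Subgroup.inclusion (lowerCentralTerm_le_isolator j)
        (⟨(g : G) ^ m, hgm⟩ : lowerCentralTerm G j) = g ^ m := rfl
    rw [this, map_pow, hg, natCast_zsmul, toAdd_pow, toAdd_ofAdd]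
  have h1 := finrank_quotient_eq_of_le_torsion hkerθ
  have h2 := (θ.quotKerEquivRange).finrank_eq
  have h3 := Submodule.finrank_quotient_add_finrank (LinearMap.range θ)
  have h4 : Module.finrank ℤ ((Fin r → ℤ) ⧸ LinearMap.range θ) = 0 :=
    Module.finrank_eq_zero_iff_isTorsion.mpr hcoker
  have h5 : lowerCentralRank G j = Module.finrank ℤ (Additive (lowerCentralQuotient G j)) := rfl
  rw [h4, Module.finrank_fin_fun, zero_add] at h3
  rw [h5, ← h1, h2, h3]

/-- The quotients of consecutive isolators are free abelian of rank `lowerCentralRank G j`. -/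
theorem exists_hom_isolator (hG : Group.FG G) (j : ℕ) (hj : 1 ≤ j) :
    ∃ ψ : lowerCentralIsolator G j →* Multiplicative (Fin (lowerCentralRank G j) → ℤ),
      Function.Surjective ψ ∧
      ψ.ker = (lowerCentralIsolator G (j + 1)).subgroupOf (lowerCentralIsolator G j) := by
  obtain ⟨K, h1, h2, h3⟩ := exists_fg_le_sup_lowerCentralTerm hG (j + 1) (by omega)
    (lowerCentralIsolator G j)
  have := fg_quotient_of_le_sup h1 h2
    (h3.trans (sup_le_sup_left (lowerCentralTerm_le_isolator (j + 1)) K))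
  obtain ⟨r, ψ, hψ, hker⟩ := exists_hom_ker_eq
    ((lowerCentralIsolator G (j + 1)).subgroupOf (lowerCentralIsolator G j))
    (fun x y => mem_subgroupOf.mpr (lowerCentralIsolator_antitone (show j + 1 ≤ j + j by omega)
      (commutator_mem_lowerCentralIsolator j j hj hj (x : G) x.2 (y : G) y.2)))
    (fun x n hn hx => mem_lowerCentralIsolator_of_pow_mem hn hx)
  obtain rfl := lowerCentralRank_eq j r ψ hψ hker
  exact ⟨ψ, hψ, hker⟩

theorem torsionFreeRank_lowerCentralQuotient (hG : Group.FG G) (j : ℕ) (hj : 1 ≤ j) :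
    torsionFreeRank (lowerCentralQuotient G j) = (lowerCentralRank G j : Cardinal) := by
  have := fg_lowerCentralQuotient hG j hj
  have : Module.Finite ℤ (Additive (lowerCentralQuotient G j)) :=
    Module.Finite.iff_addGroup_fg.mpr inferInstance
  exact (Module.finrank_eq_rank ℤ (Additive (lowerCentralQuotient G j))).symm

end FiniteGeneration

/-! ### Counting weighted families -/

section WeightedFamilies

variable {ι : Type*} [Fintype ι]

/-- The families of natural numbers supported on `A` whose weighted sum is less than `n`. -/
def weightedFamilies (ω : ι → ℕ) (A : Finset ι) (n : ℕ) : Set (ι → ℕ) :=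
  {x | (∀ i ∉ A, x i = 0) ∧ ∑ i, ω i * x i < n}

theorem weightedFamilies_finite {ω : ι → ℕ} (hω : ∀ i, 1 ≤ ω i) (A : Finset ι) (n : ℕ) :
    (weightedFamilies ω A n).Finite := by
  classical
  refine (Set.finite_Icc (0 : ι → ℕ) fun _ => n).subset ?_
  rintro x ⟨-, hx⟩
  refine ⟨fun i => Nat.zero_le _, fun i => ?_⟩
  have h1 : ω i * x i ≤ ∑ i, ω i * x i :=
    Finset.single_le_sum (f := fun i => ω i * x i) (fun _ _ => Nat.zero_le _) (Finset.mem_univ i)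
  have h2 : x i ≤ ω i * x i := Nat.le_mul_of_pos_left _ (hω i)
  change x i ≤ n
  omega

theorem weightedFamilies_zero (ω : ι → ℕ) (A : Finset ι) : weightedFamilies ω A 0 = ∅ := by
  ext x
  simp [weightedFamilies]

theorem weightedFamilies_empty (ω : ι → ℕ) {n : ℕ} (hn : n ≠ 0) :
    weightedFamilies ω ∅ n = {0} := by
  ext x
  constructor
  · rintro ⟨h, -⟩
    exact funext fun i => h i (Finset.notMem_empty i)
  · rintro rfl
    exact ⟨fun _ _ => rfl, by simpa using Nat.pos_of_ne_zero hn⟩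

/-- A family supported on `insert i A` either vanishes at `i` or arises by adding `1` at `i`. -/
theorem ncard_weightedFamilies_insert [DecidableEq ι] {ω : ι → ℕ} (hω : ∀ i, 1 ≤ ω i)
    {A : Finset ι} {i : ι} (hi : i ∉ A) (n : ℕ) :
    (weightedFamilies ω (insert i A) n).ncard =
      (weightedFamilies ω (insert i A) (n - ω i)).ncard + (weightedFamilies ω A n).ncard := by
  have hsum : ∀ x : ι → ℕ, ∑ l, ω l * (x + Pi.single i 1 : ι → ℕ) l = ∑ l, ω l * x l + ω i := by
    intro x
    simp [mul_add, Finset.sum_add_distrib, Pi.single_apply]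
  have e : weightedFamilies ω (insert i A) n =
      (fun x => x + Pi.single i 1) '' weightedFamilies ω (insert i A) (n - ω i) ∪
        weightedFamilies ω A n := by
    ext x
    constructor
    · rintro ⟨h1, h2⟩
      rcases Nat.eq_zero_or_pos (x i) with h | h
      · right
        refine ⟨fun l hl => ?_, h2⟩
        by_cases hli : l = i
        · rw [hli, h]
        · exact h1 l (by simp [hli, hl])
      · left
        have hx : x - Pi.single i 1 + Pi.single i 1 = x := by
          funext l
          by_cases hli : l = i
          · subst hli
            simp only [Pi.add_apply, Pi.sub_apply, Pi.single_eq_same]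
            omega
          · simp [hli]
        refine ⟨x - Pi.single i 1, ⟨fun l hl => ?_, ?_⟩, hx⟩
        · simp [h1 l hl]
        · have := hsum (x - Pi.single i 1)
          rw [hx] at this
          omega
    · rintro (⟨y, ⟨h1, h2⟩, rfl⟩ | ⟨h1, h2⟩)
      · refine ⟨fun l hl => ?_, ?_⟩
        · have hli : l ≠ i := fun h => hl (h ▸ Finset.mem_insert_self _ _)
          simp [h1 l hl, hli]
        · rw [hsum]
          omega
      · exact ⟨fun l hl => h1 l fun h => hl (Finset.mem_insert_of_mem h), h2⟩
  have hdisj : Disjoint ((fun x => x + Pi.single i 1) '' weightedFamilies ω (insert i A) (n - ω i))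
      (weightedFamilies ω A n) := by
    rw [Set.disjoint_left]
    rintro _ ⟨y, -, rfl⟩ ⟨h1, -⟩
    have := h1 i hi
    simp at this
  rw [e, Set.ncard_union_eq hdisj ((weightedFamilies_finite hω _ _).image _)
    (weightedFamilies_finite hω _ _),
    Set.ncard_image_of_injective _ (add_left_injective (Pi.single i 1))]

end WeightedFamilies

/-! ### The chain of subgroups -/

section Chain

variable {G : Type*} [Group G] {Γ : ℕ → Subgroup G}

/-- The dimensions of the spaces of polynomials of degree `< n ≤ N` on the subgroup `H`, filtered
by the subgroups `H ∩ Γ v`, are the numbers of families supported on `A` of weight `< n`. -/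
def HasPolyDimension (Γ : ℕ → Subgroup G) (N : ℕ) {ι : Type*} [Fintype ι] (ω : ι → ℕ)
    (H : Subgroup G) (A : Finset ι) : Prop :=
  ∀ n ≤ N, Module.rank ℂ (filteredPoly (fun v => (Γ v).comap H.subtype) n) =
    ((weightedFamilies ω A n).ncard : Cardinal)

variable {N : ℕ} {ι : Type*} [Fintype ι] {ω : ι → ℕ}

theorem hasPolyDimension_self (hN : 1 ≤ N) : HasPolyDimension Γ N ω (Γ N) ∅ := by
  intro n hn
  rcases Nat.eq_zero_or_pos n with rfl | hn0
  · rw [filteredPoly_zero, weightedFamilies_zero, Set.ncard_empty, Nat.cast_zero, rank_bot]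
  · rw [weightedFamilies_empty ω hn0.ne', Set.ncard_singleton, Nat.cast_one]
    have e : filteredPoly (fun v => (Γ v).comap (Γ N).subtype) n =
        Submodule.span ℂ {(fun _ => 1 : Γ N → ℂ)} := by
      ext f
      rw [Submodule.mem_span_singleton]
      constructor
      · intro hf
        refine ⟨f 1, funext fun g => ?_⟩
        have h := leftDeriv_mem_filteredPoly_of_le (m := 0) hf hN
          (show g ∈ (Γ N).comap (Γ N).subtype from g.2) (by omega)
        rw [filteredPoly_zero, Submodule.mem_bot] at h
        have h1 := congrFun h 1
        rw [leftDeriv_apply, mul_one] at h1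
        simpa using (sub_eq_zero.mp h1).symm
      · rintro ⟨c, rfl⟩
        rw [mem_filteredPoly hn0.ne']
        intro v hv g hg
        have : leftDeriv g (c • (fun _ => 1 : Γ N → ℂ)) = 0 := by
          funext y
          simp [leftDeriv_apply]
        rw [this]
        exact zero_mem _
    rw [e, ← Module.finrank_eq_rank,
      finrank_span_singleton fun h => one_ne_zero (congrFun h 1), Nat.cast_one]

theorem HasPolyDimension.insert [DecidableEq ι] [hnorm : ∀ v, (Γ v).Normal] (hanti : Antitone Γ)
    (hΓ : ∀ i j, 1 ≤ i → 1 ≤ j → ∀ u ∈ Γ i, ∀ v ∈ Γ j, ⁅u, v⁆ ∈ Γ (i + j))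
    (hω : ∀ i, 1 ≤ ω i) {A : Finset ι} {i : ι} (hi : i ∉ A) {H K : Subgroup G} (hHK : H ≤ K)
    (hK : K ≤ Γ (ω i)) (hH : Γ (ω i + 1) ≤ H) (a : K →* Multiplicative ℤ)
    (ha : a.ker = H.subgroupOf K) (x : K) (hax : a x = Multiplicative.ofAdd 1)
    (h : HasPolyDimension Γ N ω H A) : HasPolyDimension Γ N ω K (insert i A) := by
  intro n
  induction n using Nat.strong_induction_on with
  | _ n ih =>
    intro hn
    rcases Nat.eq_zero_or_pos n with rfl | hn0
    · rw [filteredPoly_zero, weightedFamilies_zero, Set.ncard_empty, Nat.cast_zero, rank_bot]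
    · have hωi := hω i
      rw [ncard_weightedFamilies_insert hω hi, Nat.cast_add, ← ih _ (by omega) (by omega),
        ← h n hn]
      refine rank_filteredPoly_eq_add (ι := Subgroup.inclusion hHK) (x := x)
        (Γ := fun v => (Γ v).comap K.subtype)
        (hN := fun v => (hnorm v).comap K.subtype)
        (fun _ _ hvw => Subgroup.comap_mono (hanti hvw))
        (fun i j hi hj u hu v hv => hΓ i j hi hj (u : G) hu (v : G) hv) hωi ?_ a hax ?_ ?_
        (Subgroup.inclusion_injective hHK) n
      · exact top_le_iff.mp fun g _ => hK g.2
      · rw [ha, Subgroup.inclusion_range]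
      · rw [ha]
        exact Subgroup.comap_mono hH

/-- The passage from `Γ (w + 1)` to `Γ w` through subgroups with infinite cyclic quotients, given
by the vanishing of the coordinates `t ≥ r` in `Γ w / Γ (w + 1) ≃ ℤ ^ d`. -/
theorem HasPolyDimension.union [DecidableEq ι] [hnorm : ∀ v, (Γ v).Normal] (hanti : Antitone Γ)
    (hΓ : ∀ i j, 1 ≤ i → 1 ≤ j → ∀ u ∈ Γ i, ∀ v ∈ Γ j, ⁅u, v⁆ ∈ Γ (i + j))
    (hω : ∀ i, 1 ≤ ω i) {w d : ℕ} (ψ : Γ w →* Multiplicative (Fin d → ℤ))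
    (hψ : Function.Surjective ψ) (hker : ψ.ker = (Γ (w + 1)).subgroupOf (Γ w)) {A : Finset ι}
    (σ : Fin d → ι) (hσ : Function.Injective σ) (hσω : ∀ t, ω (σ t) = w) (hσA : ∀ t, σ t ∉ A)
    (h : HasPolyDimension Γ N ω (Γ (w + 1)) A) :
    HasPolyDimension Γ N ω (Γ w) (A ∪ Finset.univ.image σ) := by
  let T : ℕ → Subgroup (Multiplicative (Fin d → ℤ)) := fun r =>
    { carrier := {v | ∀ t : Fin d, r ≤ t → v.toAdd t = 0}
      one_mem' := fun _ _ => rfl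
      mul_mem' := fun {u v} hu hv t ht => by
        rw [toAdd_mul, Pi.add_apply, hu t ht, hv t ht, add_zero]
      inv_mem' := fun {u} hu t ht => by
        rw [toAdd_inv, Pi.neg_apply, hu t ht, neg_zero] }
  let S : ℕ → Subgroup G := fun r => ((T r).comap ψ).map (Γ w).subtype
  have hS : ∀ (r : ℕ) (g : Γ w), (g : G) ∈ S r ↔ ∀ t : Fin d, r ≤ t → (ψ g).toAdd t = 0 := by
    intro r g
    constructor
    · rintro ⟨g', hg', e⟩
      obtain rfl : g' = g := Subtype.ext e
      exact hg'
    · exact fun hg => ⟨g, hg, rfl⟩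
  have hSle : ∀ r, S r ≤ Γ w := by
    rintro r _ ⟨g, -, rfl⟩
    exact g.2
  have hψ1 : ∀ g : Γ w, ψ g = 1 ↔ (g : G) ∈ Γ (w + 1) := fun g => by
    rw [← MonoidHom.mem_ker, hker, Subgroup.mem_subgroupOf]
  have hleS : ∀ r, Γ (w + 1) ≤ S r := by
    intro r g hg
    rw [hS r ⟨g, hanti (Nat.le_succ w) hg⟩, (hψ1 _).mpr hg]
    exact fun _ _ => rfl
  have hS0 : S 0 = Γ (w + 1) := by
    refine le_antisymm (fun g hg => ?_) (hleS 0)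
    have := (hS 0 ⟨g, hSle 0 hg⟩).mp hg
    refine (hψ1 ⟨g, hSle 0 hg⟩).mp ?_
    exact Multiplicative.toAdd.injective (funext fun t => this t (Nat.zero_le _))
  have hSd : S d = Γ w := by
    refine le_antisymm (hSle d) fun g hg => ?_
    rw [hS d ⟨g, hg⟩]
    exact fun t ht => absurd t.2 (by omega)
  have main : ∀ r ≤ d, HasPolyDimension Γ N ω (S r)
      (A ∪ (Finset.univ.filter fun t : Fin d => (t : ℕ) < r).image σ) := by
    intro r
    induction r with
    | zero =>
      intro _
      simpa [hS0] using h
    | succ r ih =>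
      intro hr
      let t₀ : Fin d := ⟨r, hr⟩
      have hA : A ∪ (Finset.univ.filter fun t : Fin d => (t : ℕ) < r + 1).image σ =
          Insert.insert (σ t₀) (A ∪ (Finset.univ.filter fun t : Fin d => (t : ℕ) < r).image σ) := by
        rw [← Finset.union_insert, ← Finset.image_insert]
        congr 2
        ext t
        simp only [Finset.mem_filter, Finset.mem_univ, true_and, Finset.mem_insert, t₀, Fin.ext_iff]
        omega
      have hnot : σ t₀ ∉ A ∪ (Finset.univ.filter fun t : Fin d => (t : ℕ) < r).image σ := by
        rw [Finset.mem_union, not_or]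
        refine ⟨hσA t₀, fun hm => ?_⟩
        obtain ⟨t, ht, e⟩ := Finset.mem_image.mp hm
        have ht' := (Finset.mem_filter.mp ht).2
        rw [hσ e] at ht'
        exact lt_irrefl r ht'
      have hSS : S r ≤ S (r + 1) := by
        intro g hg
        have := (hS r ⟨g, hSle r hg⟩).mp hg
        exact (hS (r + 1) ⟨g, hSle r hg⟩).mpr fun t ht => this t (by omega)
      let a : S (r + 1) →* Multiplicative ℤ :=
        (AddMonoidHom.toMultiplicative (Pi.evalAddMonoidHom (fun _ : Fin d => ℤ) t₀)).comp
          (ψ.comp (Subgroup.inclusion (hSle (r + 1))))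
      have ha : ∀ g, (a g).toAdd = (ψ (Subgroup.inclusion (hSle (r + 1)) g)).toAdd t₀ :=
        fun _ => rfl
      obtain ⟨x, hx⟩ := hψ (Multiplicative.ofAdd (Pi.single t₀ 1))
      have hxS : (x : G) ∈ S (r + 1) := by
        rw [hS, hx]
        intro t ht
        have : t ≠ t₀ := fun h => by
          rw [h] at ht
          exact absurd ht (Nat.not_succ_le_self r)
        rw [toAdd_ofAdd, Pi.single_eq_of_ne this]
      rw [hA]
      refine HasPolyDimension.insert hanti hΓ hω hnot hSS ?_ ?_ a ?_ ⟨x, hxS⟩ ?_ (ih (by omega))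
      · rw [hσω]
        exact hSle _
      · rw [hσω]
        exact hleS r
      · ext g
        rw [MonoidHom.mem_ker, Subgroup.mem_subgroupOf, ← toAdd_eq_zero, ha]
        have h1 := hS r (Subgroup.inclusion (hSle (r + 1)) g)
        have h2 := (hS (r + 1) (Subgroup.inclusion (hSle (r + 1)) g)).mp g.2
        refine Iff.trans ?_ h1.symm
        constructor
        · intro h0 t ht
          rcases Nat.eq_or_lt_of_le ht with h3 | h3
          · rwa [show t = t₀ from Fin.ext h3.symm]
          · exact h2 t h3
        · exact fun h3 => h3 t₀ le_rfl
      · apply Multiplicative.toAdd.injective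
        rw [ha]
        change (ψ x).toAdd t₀ = _
        rw [hx, toAdd_ofAdd, Pi.single_eq_same, toAdd_ofAdd]
  have hd := main d le_rfl
  rw [hSd, Finset.filter_true_of_mem fun t _ => t.2] at hd
  exact hd

theorem rank_filteredPoly_comap_equiv.{u} {G H : Type u} [Group G] [Group H] (e : H ≃* G)
    (Γ : ℕ → Subgroup G) (n : ℕ) :
    Module.rank ℂ (filteredPoly (fun v => (Γ v).comap e.toMonoidHom) n) =
      Module.rank ℂ (filteredPoly Γ n) := by
  refine (LinearEquiv.ofSubmodules (LinearEquiv.funCongrLeft ℂ ℂ e.toEquiv) _ _ ?_).rank_eq.symm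
  refine le_antisymm ?_ fun F hF => ?_
  · rintro _ ⟨f, hf, rfl⟩
    exact comp_mem_filteredPoly_comap e.toMonoidHom n hf
  · have h := comp_mem_filteredPoly_comap e.symm.toMonoidHom n hF
    have hΓ : (fun v => ((Γ v).comap e.toMonoidHom).comap e.symm.toMonoidHom) = Γ := by
      funext v
      ext g
      simp
    rw [hΓ] at h
    refine ⟨_, h, funext fun y => ?_⟩
    change F (e.symm (e y)) = F y
    rw [e.symm_apply_apply]

end Chain

/-! ### Polynomials and the isolator filtration -/

section Polynomials

variable {G : Type*} [Group G]

variable (G) in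
/-- The polynomials of degree `< n` on `G`. -/
def polyOfDegreeLT : ℕ → Submodule ℂ (G → ℂ)
  | 0 => ⊥
  | n + 1 => polyOfDegreeLE G n

theorem mem_polyOfDegreeLT_succ {n : ℕ} {f : G → ℂ} :
    f ∈ polyOfDegreeLT G (n + 1) ↔ ∀ u, leftDeriv u f ∈ polyOfDegreeLT G n := by
  have happ : ∀ (us : List G) (u : G), iterLeftDeriv (us ++ [u]) f =
      iterLeftDeriv us (leftDeriv u f) := fun us u => by
    rw [iterLeftDeriv, List.foldr_append]
    rfl
  cases n with
  | zero =>
    constructor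
    · intro hf u
      exact hf [u] rfl
    · intro hf us hus
      obtain ⟨u, rfl⟩ := List.length_eq_one_iff.mp hus
      exact hf u
  | succ n =>
    constructor
    · intro hf u us hus
      rw [← happ]
      exact hf _ (by rw [List.length_append, hus]; rfl)
    · intro hf us hus
      obtain ⟨us, u, rfl⟩ : ∃ vs v, us = vs ++ [v] :=
        ⟨us.dropLast, us.getLast (List.ne_nil_of_length_eq_add_one hus),
          (List.dropLast_append_getLast _).symm⟩
      rw [happ]
      exact hf u us (by simpa using hus)

theorem polyOfDegreeLT_mono : Monotone (polyOfDegreeLT G) := by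
  refine monotone_nat_of_le_succ fun n => ?_
  induction n with
  | zero => exact bot_le
  | succ n ih =>
    intro f hf
    rw [mem_polyOfDegreeLT_succ] at hf ⊢
    exact fun u => ih (hf u)

theorem lowerCentralTerm_le_loweringSubgroup (j : ℕ) (hj : 1 ≤ j) :
    lowerCentralTerm G j ≤
      loweringSubgroup (polyOfDegreeLT G) rfl polyOfDegreeLT_mono j hj := by
  induction j, hj using Nat.le_induction with
  | base =>
    intro g _ n f hf
    cases n with
    | zero =>
      rw [show f = 0 from hf, map_zero]
      exact zero_mem _
    | succ n => exact mem_polyOfDegreeLT_succ.mp hf g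
  | succ j hj ih =>
    rw [lowerCentralTerm_succ G j hj, Subgroup.commutator_comm, Subgroup.commutator_le]
    intro u hu v hv
    refine commutator_mem_loweringSubgroup (hi := hj) (hj := le_rfl) (ih hu) ?_
    intro n f hf
    cases n with
    | zero =>
      rw [show f = 0 from hf, map_zero]
      exact zero_mem _
    | succ n => exact mem_polyOfDegreeLT_succ.mp hf v

/-- The polynomials in the sense of the lower central series are the same as those in the sense of
its isolators. -/
theorem filteredPoly_isolator_eq (n : ℕ) :
    filteredPoly (lowerCentralIsolator G) n = polyOfDegreeLT G n := by
  refine le_antisymm ?_ (le_filteredPoly rfl (fun v hv g hg => ?_) n)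
  · induction n with
    | zero => rw [filteredPoly_zero]; exact bot_le
    | succ n ih =>
      intro f hf
      rw [mem_polyOfDegreeLT_succ]
      intro u
      refine ih (leftDeriv_mem_filteredPoly_of_le hf le_rfl ?_ le_rfl)
      rw [lowerCentralIsolator_one]
      exact Subgroup.mem_top u
  · obtain ⟨m, hm, h⟩ := hg
    refine mem_loweringSubgroup.mp (mem_loweringSubgroup_of_pow_mem (h0 := rfl)
      (hM := polyOfDegreeLT_mono) (hv := hv) hm ?_ (lowerCentralTerm_le_loweringSubgroup v hv h))
    exact lowerCentralTerm_le_loweringSubgroup 1 le_rfl (Subgroup.mem_top g)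

theorem rank_polyOfDegreeLE (hG : Group.FG G) (k : ℕ) :
    Module.rank ℂ (polyOfDegreeLE G k) =
      ((weightedFamilies (fun i : (j : Finset.Icc 1 k) × Fin (lowerCentralRank G j) => (i.1 : ℕ))
        Finset.univ (k + 1)).ncard : Cardinal) := by
  have hω : ∀ i : (j : Finset.Icc 1 k) × Fin (lowerCentralRank G j), 1 ≤ (i.1 : ℕ) :=
    fun i => (Finset.mem_Icc.mp i.1.2).1
  have main : ∀ m ≤ k, HasPolyDimension (lowerCentralIsolator G) (k + 1)
      (fun i : (j : Finset.Icc 1 k) × Fin (lowerCentralRank G j) => (i.1 : ℕ))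
      (lowerCentralIsolator G (k + 1 - m))
      (Finset.univ.filter fun i => k + 1 - m ≤ (i.1 : ℕ)) := by
    intro m
    induction m with
    | zero =>
      intro _
      rw [Finset.filter_false_of_mem fun i _ => by
        have := (Finset.mem_Icc.mp i.1.2).2
        omega]
      exact hasPolyDimension_self (by omega)
    | succ m ih =>
      intro hm
      have h := ih (by omega)
      obtain ⟨w, hw⟩ : ∃ w, w = k + 1 - (m + 1) := ⟨_, rfl⟩
      rw [show k + 1 - m = w + 1 by omega] at h
      rw [← hw]
      have hwk : w ∈ Finset.Icc 1 k := Finset.mem_Icc.mpr (by omega)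
      obtain ⟨ψ, hψ, hker⟩ := exists_hom_isolator hG w (by omega)
      let σ : Fin (lowerCentralRank G w) → (j : Finset.Icc 1 k) × Fin (lowerCentralRank G j) :=
        fun t => ⟨⟨w, hwk⟩, t⟩
      have hA : (Finset.univ.filter fun i : (j : Finset.Icc 1 k) × Fin (lowerCentralRank G j) =>
          w ≤ (i.1 : ℕ)) = (Finset.univ.filter fun i => w + 1 ≤ (i.1 : ℕ)) ∪
            Finset.univ.image σ := by
        ext i
        simp only [Finset.mem_union, Finset.mem_filter, Finset.mem_univ, true_and,
          Finset.mem_image]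
        constructor
        · intro hi
          rcases Nat.eq_or_lt_of_le hi with h1 | h1
          · right
            obtain ⟨⟨j, hj⟩, t⟩ := i
            change w = j at h1
            subst h1
            exact ⟨t, rfl⟩
          · exact Or.inl h1
        · rintro (h1 | ⟨t, rfl⟩)
          · omega
          · exact le_rfl
      rw [hA]
      refine HasPolyDimension.union lowerCentralIsolator_antitone
        commutator_mem_lowerCentralIsolator hω ψ hψ hker σ ?_ (fun _ => rfl) ?_ h
      · intro t t' e
        exact eq_of_heq (Sigma.mk.inj e).2
      · intro t ht
        exact absurd (Finset.mem_filter.mp ht).2 (Nat.not_succ_le_self w)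
  have h := main k le_rfl (k + 1) le_rfl
  rw [show k + 1 - k = 1 by omega, lowerCentralIsolator_one,
    Finset.filter_true_of_mem fun i _ => hω i] at h
  rw [← h]
  have h2 := rank_filteredPoly_comap_equiv (Subgroup.topEquiv (G := G)) (lowerCentralIsolator G)
    (k + 1)
  rw [filteredPoly_isolator_eq] at h2
  exact h2.symm

theorem weightedSolutions_natCast (d : ℕ → ℕ) (k : ℕ) :
    weightedSolutions d (Int.ofNat k) = Equiv.piCurry (fun _ _ => ℕ) ''
      weightedFamilies (fun i : (j : Finset.Icc 1 k) × Fin (d j) => (i.1 : ℕ))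
        Finset.univ (k + 1) := by
  rw [Equiv.image_eq_preimage_symm]
  ext x
  have : ∑ i : (j : Finset.Icc 1 k) × Fin (d j), (i.1 : ℕ) * x i.1 i.2 =
      ∑ j : Finset.Icc 1 k, (j : ℕ) * ∑ t : Fin (d j), x j t := by
    rw [Fintype.sum_sigma]
    exact Finset.sum_congr rfl fun j _ =>
      (Finset.mul_sum Finset.univ (fun t => x j t) (j : ℕ)).symm
  change ((∑ j : Finset.Icc 1 k, (j : ℕ) * ∑ t : Fin (d j), x j t : ℕ) : ℤ) ≤ (k : ℤ) ↔
    (∀ i ∉ Finset.univ, _) ∧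
      ∑ i : (j : Finset.Icc 1 k) × Fin (d j), (i.1 : ℕ) * x i.1 i.2 < k + 1
  rw [this, Nat.cast_le, Nat.lt_succ_iff]
  simp

end Polynomials

theorem mainTheorem5 (G : Type*) [Group G] (hG : Group.FG G) :
    (∀ j : ℕ, 1 ≤ j →
      torsionFreeRank (lowerCentralQuotient G j) = (lowerCentralRank G j : Cardinal)) ∧
    ∀ k : ℤ,
      (weightedSolutions (lowerCentralRank G) k).Finite ∧
      Module.rank ℂ (polySpace G k) =
        ((weightedSolutions (lowerCentralRank G) k).ncard : Cardinal) := by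
  refine ⟨torsionFreeRank_lowerCentralQuotient hG, fun k => ?_⟩
  cases k with
  | ofNat k =>
    rw [weightedSolutions_natCast, Set.ncard_image_of_injective _ (Equiv.injective _)]
    refine ⟨(weightedFamilies_finite (fun i => ?_) _ _).image _, rank_polyOfDegreeLE hG k⟩
    exact (Finset.mem_Icc.mp i.1.2).1
  | negSucc k =>
    have h : weightedSolutions (lowerCentralRank G) (Int.negSucc k) = ∅ := by
      ext x
      simp only [weightedSolutions, Set.mem_ofPred_eq, Set.mem_empty_iff_false, iff_false, not_le]
      exact (Int.negSucc_lt_zero k).trans_le (Int.natCast_nonneg _)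
    rw [h, Set.ncard_empty, Nat.cast_zero]
    exact ⟨Set.finite_empty, rank_bot ℂ (G → ℂ)⟩
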